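/- All Banach spaces are real. For a Banach space $X$, $\mathrm{Lip}_0(X)$ is the space of Lipschitz functions $f:X\to\mathbb R$ with $f(0)=0$, normed by the best Lipschitz constant, and $\mathfrak F(X)=\overline{\mathrm{span}}\{\delta_x:x\in X\}\subseteq \mathrm{Lip}_0(X)^*$, where $\delta_x(f)=f(x)$, is the Lipschitz-free space over $X$. An operator ideal $\mathcal A$ assigns to all Banach spaces $X,Y$ a linear subspace $\mathcal A(X,Y)$ of the space $\mathcal L(X,Y)$ of bounded operators that contains the rank one operators, such that $RTS\in\mathcal A(W,Z)$ whenever $S\in\mathcal L(W,X)$, $T\in\mathcal A(X,Y)$, $R\in\mathcal L(Y,Z)$. For $\lambda\ge 1$, $X$ has the $\mathcal A$-$\lambda$-bounded approximation property ($\mathcal A$-$\lambda$-BAP) if $\mathrm{Id}_X$ belongs to the closure of $\{T\in\mathcal A(X,X):\|T\|\le\lambda\}$ in the compact-open topology. We write $T^{**}\in\mathcal A(Z^{**},Z)$ if $T^{**}=j_ZS$ for some $S\in\mathcal A(Z^{**},Z)$, where $j_Z:Z\to Z^{**}$ is the canonical embedding. Proposition. Let $\mathcal A$ be an operator ideal and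 $X$ a Banach space such that $T^{**}\in\mathcal A(\mathfrak F(X)^{**},\mathfrak F(X))$ whenever $T\in\mathcal A(\mathfrak F(X),\mathfrak F(X))$. Then, for every $\lambda\ge1$, $X$ has the $\mathcal A$-$\lambda$-BAP if $\mathfrak F(X)$ has the $\mathcal A$-$\lambda$-BAP. Moreover, the classes $\mathcal A=\mathcal F$ (finite rank operators), $\mathcal K$ (compact operators), $\mathcal W$ (weakly compact operators), $\mathcal K_p$ ($p$-compact operators) and $\Pi_p$ ($p$-summing operators), $1\le p<\infty$, are operator ideals that satisfy the above assumption for every Banach space $X$; hence for each of them, every Banach space $X$ and every $\lambda\ge1$, $X$ has the $\mathcal A$-$\lambda$-BAP if $\mathfrak F(X)$ has it. Here $T\in\mathcal L(X,Y)$ is $p$-compact if there is a sequence $(y_n)$ in $Y$ with $\sum_n\|y_n\|^p<\infty$ such that the image of the closed unit ball of $X$ under $T$ is contained in $\{\sum_n a_ny_n:\|(a_n)\|_{\ell_q}\le1\}$, $\frac1p+\frac1q=1$ ($q=\infty$ if $p=1$); and $T$ is $p$-summing if there is $C\ge 0$ such that $\big(\sum_{i=1}^n\|Tx_i\|^p\big)^{1/p}\le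 C\sup_{\varphi\in X^*,\,\|\varphi\|\le1}\big(\sum_{i=1}^n|\varphi(x_i)|^p\big)^{1/p}$ for all $n$ and $x_1,\dots,x_n\in X$. -/

import Mathlib

universe u

noncomputable section

/-! ### The space `Lip₀(X)` of real Lipschitz functions vanishing at the origin -/

/-- Lipschitz functions `X → ℝ` vanishing at `0`, as a subspace of all functions. -/
def lipZeroSubmodule (X : Type u) [NormedAddCommGroup X] : Submodule ℝ (X → ℝ) where
  carrier := {f | f 0 = 0 ∧ ∃ K, LipschitzWith K f}
  zero_mem' := ⟨rfl, 0, LipschitzWith.const 0⟩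
  add_mem' := by
    rintro f g ⟨hf, K, hK⟩ ⟨hg, L, hL⟩
    exact ⟨by simp [hf, hg], K + L, hK.add hL⟩
  smul_mem' := by
    rintro c f ⟨hf, K, hK⟩
    exact ⟨by simp [hf], ‖c‖₊ * K, (lipschitzWith_smul c).comp hK⟩

/-- `Lip₀(X)`, as a type; it is normed by the Lipschitz norm. -/
def LipZero (X : Type u) [NormedAddCommGroup X] : Type u := ↥(lipZeroSubmodule X)

namespace LipZero

variable {X : Type u} [NormedAddCommGroup X]

instance : AddCommGroup (LipZero X) := inferInstanceAs (AddCommGroup ↥(lipZeroSubmodule X))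

instance : Module ℝ (LipZero X) := inferInstanceAs (Module ℝ ↥(lipZeroSubmodule X))

instance : CoeFun (LipZero X) (fun _ => X → ℝ) := ⟨fun f => f.1⟩

@[simp] theorem add_apply (f g : LipZero X) (x : X) : (f + g) x = f x + g x := rfl

@[simp] theorem smul_apply (c : ℝ) (f : LipZero X) (x : X) : (c • f) x = c * f x := rfl

@[simp] theorem apply_zero (f : LipZero X) : f 0 = 0 := f.2.1

/-- The Lipschitz norm `sup |f x - f y| / ‖x - y‖` (pairs with `x = y` contribute `0 / 0 = 0`). -/
instance : Norm (LipZero X) := ⟨fun f => ⨆ z : X × X, |f z.1 - f z.2| / ‖z.1 - z.2‖⟩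

theorem norm_def (f : LipZero X) : ‖f‖ = ⨆ z : X × X, |f z.1 - f z.2| / ‖z.1 - z.2‖ := rfl

theorem bddAbove_slopes (f : LipZero X) :
    BddAbove (Set.range fun z : X × X => |f z.1 - f z.2| / ‖z.1 - z.2‖) := by
  obtain ⟨K, hK⟩ := f.2.2
  refine ⟨K, ?_⟩
  rintro _ ⟨z, rfl⟩
  have h := hK.dist_le_mul z.1 z.2
  rw [Real.dist_eq, dist_eq_norm] at h
  exact div_le_of_le_mul₀ (norm_nonneg _) K.2 h

theorem abs_sub_le (f : LipZero X) (x y : X) : |f x - f y| ≤ ‖f‖ * ‖x - y‖ := by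
  rcases eq_or_ne x y with rfl | hxy
  · simp
  · have hpos : 0 < ‖x - y‖ := norm_pos_iff.2 (sub_ne_zero.2 hxy)
    rw [← div_le_iff₀ hpos]
    exact le_ciSup (bddAbove_slopes f) (x, y)

theorem abs_le (f : LipZero X) (x : X) : |f x| ≤ ‖f‖ * ‖x‖ := by
  simpa using abs_sub_le f x 0

theorem norm_le_of (f : LipZero X) {C : ℝ} (hC : 0 ≤ C)
    (h : ∀ x y, |f x - f y| ≤ C * ‖x - y‖) : ‖f‖ ≤ C :=
  ciSup_le fun z => div_le_of_le_mul₀ (norm_nonneg _) hC (h z.1 z.2)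

theorem norm_nonneg' (f : LipZero X) : 0 ≤ ‖f‖ :=
  Real.iSup_nonneg fun _ => div_nonneg (abs_nonneg _) (norm_nonneg _)

theorem normCore (X : Type u) [NormedAddCommGroup X] : NormedSpace.Core ℝ (LipZero X) where
  norm_nonneg := norm_nonneg'
  norm_smul c f := by
    rw [norm_def, norm_def, Real.mul_iSup_of_nonneg (norm_nonneg c)]
    refine iSup_congr fun z => ?_
    rw [smul_apply, smul_apply, ← mul_sub, abs_mul, mul_div_assoc, Real.norm_eq_abs]
  norm_triangle f g := by
    refine norm_le_of _ (add_nonneg (norm_nonneg' f) (norm_nonneg' g)) fun x y => ?_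
    rw [add_apply, add_apply, add_sub_add_comm, add_mul]
    exact (abs_add_le _ _).trans (add_le_add (abs_sub_le f x y) (abs_sub_le g x y))
  norm_eq_zero_iff f := by
    constructor
    · intro h
      refine Subtype.ext (funext fun x => ?_)
      have := abs_le f x
      rw [h, zero_mul] at this
      exact abs_eq_zero.1 (le_antisymm this (abs_nonneg _))
    · rintro rfl
      refine le_antisymm (norm_le_of _ le_rfl fun x y => ?_) (norm_nonneg' _)
      change |(0 : ℝ) - 0| ≤ _
      simp

instance : NormedAddCommGroup (LipZero X) := NormedAddCommGroup.ofCore (normCore X)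

instance : NormedSpace ℝ (LipZero X) := NormedSpace.ofCore (normCore X)

/-- The evaluation functional `δ_x` on `Lip₀(X)`. -/
def eval (x : X) : StrongDual ℝ (LipZero X) :=
  LinearMap.mkContinuous
    { toFun := fun f => f x
      map_add' := fun _ _ => rfl
      map_smul' := fun _ _ => rfl }
    ‖x‖ fun f => by
      rw [mul_comm]
      exact abs_le f x

@[simp] theorem eval_apply (x : X) (f : LipZero X) : eval x f = f x := rfl

end LipZero

/-- The Lipschitz-free space over `X`: the closed linear span of the evaluation functionals
in `Lip₀(X)*`, with the norm of `Lip₀(X)*`. -/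
abbrev LipFree (X : Type u) [NormedAddCommGroup X] : Type u :=
  ↥(Submodule.span ℝ (Set.range (LipZero.eval (X := X)))).topologicalClosure

/-! ### Operator ideals -/

/-- A class of bounded operators between real Banach spaces: a subset of `L(X, Y)` for all
Banach spaces `X`, `Y`. -/
def OperatorClass : Type (u + 1) :=
  ∀ (X Y : Type u) [NormedAddCommGroup X] [NormedSpace ℝ X] [CompleteSpace X]
    [NormedAddCommGroup Y] [NormedSpace ℝ Y] [CompleteSpace Y], Set (X →L[ℝ] Y)

/-- `A` is a (linear) operator ideal: every component `A(X, Y)` is a linear subspace of `L(X, Y)`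
containing the rank one operators, and `R T S ∈ A(W, Z)` whenever `T ∈ A(X, Y)`. -/
structure IsOperatorIdeal (A : OperatorClass.{u}) : Prop where
  zero_mem : ∀ (X Y : Type u) [NormedAddCommGroup X] [NormedSpace ℝ X] [CompleteSpace X]
    [NormedAddCommGroup Y] [NormedSpace ℝ Y] [CompleteSpace Y],
    (0 : X →L[ℝ] Y) ∈ A X Y
  add_mem : ∀ (X Y : Type u) [NormedAddCommGroup X] [NormedSpace ℝ X] [CompleteSpace X]
    [NormedAddCommGroup Y] [NormedSpace ℝ Y] [CompleteSpace Y] (S T : X →L[ℝ] Y),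
    S ∈ A X Y → T ∈ A X Y → S + T ∈ A X Y
  smul_mem : ∀ (X Y : Type u) [NormedAddCommGroup X] [NormedSpace ℝ X] [CompleteSpace X]
    [NormedAddCommGroup Y] [NormedSpace ℝ Y] [CompleteSpace Y] (c : ℝ) (T : X →L[ℝ] Y),
    T ∈ A X Y → c • T ∈ A X Y
  rankOne_mem : ∀ (X Y : Type u) [NormedAddCommGroup X] [NormedSpace ℝ X] [CompleteSpace X]
    [NormedAddCommGroup Y] [NormedSpace ℝ Y] [CompleteSpace Y] (φ : StrongDual ℝ X) (y : Y),
    φ.smulRight y ∈ A X Y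
  comp_mem : ∀ (W X Y Z : Type u) [NormedAddCommGroup W] [NormedSpace ℝ W] [CompleteSpace W]
    [NormedAddCommGroup X] [NormedSpace ℝ X] [CompleteSpace X]
    [NormedAddCommGroup Y] [NormedSpace ℝ Y] [CompleteSpace Y]
    [NormedAddCommGroup Z] [NormedSpace ℝ Z] [CompleteSpace Z]
    (S : W →L[ℝ] X) (T : X →L[ℝ] Y) (R : Y →L[ℝ] Z),
    T ∈ A X Y → R ∘L T ∘L S ∈ A W Z

/-- The conjugate operator `T* : Y* → X*`, `T* φ = φ ∘ T`. -/
def conjOp {X Y : Type u} [NormedAddCommGroup X] [NormedSpace ℝ X] [NormedAddCommGroup Y]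
    [NormedSpace ℝ Y] (T : X →L[ℝ] Y) : StrongDual ℝ Y →L[ℝ] StrongDual ℝ X :=
  ContinuousLinearMap.precomp ℝ T

/-- `T ∈ A(Z, Z)` implies `T** ∈ A(Z**, Z)`: the operator `T**` takes its values in the canonical
copy of `Z` in `Z**`, and belongs to `A` as an operator from `Z**` to `Z`. -/
def BidualCondition (A : OperatorClass.{u}) (Z : Type u) [NormedAddCommGroup Z] [NormedSpace ℝ Z]
    [CompleteSpace Z] : Prop :=
  ∀ T ∈ A Z Z, ∃ S ∈ A (StrongDual ℝ (StrongDual ℝ Z)) Z,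
    NormedSpace.inclusionInDoubleDual ℝ Z ∘L S = conjOp (conjOp T)

/-- The `A`-`l`-bounded approximation property: the identity of `X` lies in the closure, for the
compact-open topology (the topology of `C(X, X)`), of `{T ∈ A(X, X) : ‖T‖ ≤ l}`. -/
def HasBAP (A : OperatorClass.{u}) (l : ℝ) (X : Type u) [NormedAddCommGroup X] [NormedSpace ℝ X]
    [CompleteSpace X] : Prop :=
  ContinuousMap.id X ∈
    closure ((fun T : X →L[ℝ] X => (⟨T, T.continuous⟩ : C(X, X))) '' {T | T ∈ A X X ∧ ‖T‖ ≤ l})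

/-! ### The classical operator ideals -/

/-- `F`: operators with finite-dimensional range. -/
def finiteRankOps : OperatorClass.{u} := fun X Y _ _ _ _ _ _ =>
  {T : X →L[ℝ] Y | FiniteDimensional ℝ (LinearMap.range (T : X →ₗ[ℝ] Y))}

/-- `K`: compact operators. -/
def compactOps : OperatorClass.{u} := fun X Y _ _ _ _ _ _ =>
  {T : X →L[ℝ] Y | IsCompactOperator T}

/-- `W`: weakly compact operators, i.e. the image of the closed unit ball is relatively compact
for the weak topology. -/
def weaklyCompactOps : OperatorClass.{u} := fun X Y _ _ _ _ _ _ =>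
  {T : X →L[ℝ] Y | IsCompact (closure (toWeakSpace ℝ Y '' (T '' Metric.closedBall 0 1)))}

/-- A set `K` is relatively `p`-compact if there is a sequence `(xₙ)` with `∑ ‖xₙ‖ ^ p < ∞` such
that `K ⊆ {∑ aₙ xₙ : (aₙ) ∈ ℓ_q, ‖a‖_q ≤ 1}`, where `1 / p + 1 / q = 1` (`q = ∞` if `p = 1`). -/
def IsRelPCompact (p : ℝ) {Y : Type u} [NormedAddCommGroup Y] [NormedSpace ℝ Y] (K : Set Y) :
    Prop :=
  ∃ x : ℕ → Y, Summable (fun n => ‖x n‖ ^ p) ∧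
    ∀ y ∈ K, ∃ a : lp (fun _ : ℕ => ℝ) (ENNReal.conjExponent (ENNReal.ofReal p)),
      ‖a‖ ≤ 1 ∧ HasSum (fun n => a n • x n) y

/-- `K_p`: `p`-compact operators, i.e. the image of the closed unit ball is relatively
`p`-compact. -/
def pCompactOps (p : ℝ) : OperatorClass.{u} := fun X Y _ _ _ _ _ _ =>
  {T : X →L[ℝ] Y | IsRelPCompact p (T '' Metric.closedBall 0 1)}

/-- `Π_p`: (absolutely) `p`-summing operators. -/
def pSummingOps (p : ℝ) : OperatorClass.{u} := fun X Y _ _ _ _ _ _ =>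
  {T : X →L[ℝ] Y | ∃ C : ℝ, 0 ≤ C ∧ ∀ (n : ℕ) (x : Fin n → X),
    (∑ i, ‖T (x i)‖ ^ p) ^ (1 / p) ≤
      C * ⨆ φ : {φ : StrongDual ℝ X // ‖φ‖ ≤ 1}, (∑ i, |φ.1 (x i)| ^ p) ^ (1 / p)}

end

section

set_option maxSynthPendingDepth 3
set_option linter.unusedSectionVars false

open Filter Topology

/-! ### Goldstine's theorem -/

section Bidual

variable {X Y : Type*} [NormedAddCommGroup X] [NormedSpace ℝ X]
  [NormedAddCommGroup Y] [NormedSpace ℝ Y]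

/-! The barycenter map `β : 𝔉(X) → X` is a norm-one linear left inverse of `x ↦ δ_x`. If it had a
linear right inverse `R` of norm one, `β T R` would transfer approximations of the identity from
`𝔉(X)` to `X`. In general there need be no such `R`, but a local substitute with values in `𝔉(X)**`
suffices. By `exists_linear_lifting`, for each finite `s ⊆ X` and each error there is a linear `R :
X → 𝔉(X)**` with `‖R‖ ≤ 1` such that `R x` is close, for `x ∈ s`, to an element `z x` of `𝔉(X)` with
`β (z x) = x`. If `T` almost fixes the finitely many `z x`, and `S : 𝔉(X)** → 𝔉(X)` in the ideal
represents `T**`, then `β S R` lies in the ideal, has norm at most `‖T‖`, and almost fixes `s`;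
compact sets follow by a finite net (`HasBAP.of_lipFree`).

The lifting is a discrete form of "smooth, then differentiate". The group algebra `ℝ[X]` acts on
functions on `X` by translation. Averaging along multiples of `v` telescopes against the difference
operator of `v`, so difference quotients of the averaged map `x ↦ δ_x` are almost additive
(`exists_almost_linear`). A weak* limit along an ultrafilter is additive and bounded, hence linear.
Two scales of averaging keep the targets `z x` fixed during this limit.

For finite rank, compact, weakly compact and `p`-compact operators, Goldstine's theorem shows that
`T**` maps the bidual ball into the same (weakly) compact set that contains the image of the ball
under `T` (`exists_bidual_of_isCompact`). For `p`-summing operators two facts are needed. That `T**`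
takes values in the space comes from a Pietsch-type domination by a uniformly convex function
(`exists_dominatingPair`, `mem_closure_range_of_uniformlyConvex`). That the resulting operator is
`p`-summing comes from a finite-dimensional duality argument in place of local reflexivity
(`finPNorm_bidual_le`). -/

/-- A finite form of Goldstine's theorem. -/
theorem exists_norm_le_one_forall_abs_sub_lt {ξ : StrongDual ℝ (StrongDual ℝ X)} (hξ : ‖ξ‖ ≤ 1)
    (s : Finset (StrongDual ℝ X)) {ε : ℝ} (hε : 0 < ε) :
    ∃ x : X, ‖x‖ ≤ 1 ∧ ∀ f ∈ s, |f x - ξ f| < ε := by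
  classical
  let L : X →L[ℝ] (s → ℝ) := ContinuousLinearMap.pi fun f => f.1
  let a : s → ℝ := fun f => ξ f.1
  have ha : a ∈ closure (L '' Metric.closedBall 0 1) := by
    by_contra hcon
    obtain ⟨f, c, hfc, hca⟩ := geometric_hahn_banach_closed_point
      (((convex_closedBall (0 : X) 1).linear_image L.toLinearMap).closure) isClosed_closure hcon
    have hle : ∀ x : X, ‖x‖ ≤ 1 → f (L x) < c := fun x hx =>
      hfc _ (subset_closure ⟨x, by simpa using hx, rfl⟩)
    have hc : 0 ≤ c := by simpa using (hle 0 (by simp)).le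
    have hnorm : ‖f ∘L L‖ ≤ c := by
      refine ContinuousLinearMap.opNorm_le_of_unit_norm hc fun x hx => ?_
      rw [Real.norm_eq_abs, abs_le]
      have h1 := (hle x hx.le).le
      have h2 := (hle (-x) (by simp [hx])).le
      simp only [map_neg] at h2
      exact ⟨by simp only [ContinuousLinearMap.comp_apply]; linarith, h1⟩
    have hrep : ∀ b : s → ℝ, f b = ∑ i, b i * f (Pi.single i 1) := fun b => by
      conv_lhs => rw [pi_eq_sum_univ' b]
      rw [map_sum]
      refine Finset.sum_congr rfl fun i _ => ?_
      rw [map_smul, smul_eq_mul]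
    have hfL : f ∘L L = ∑ i : s, f (Pi.single i 1) • i.1 := by
      ext x
      rw [ContinuousLinearMap.comp_apply, hrep, _root_.sum_apply]
      exact Finset.sum_congr rfl fun i _ => mul_comm _ _
    -- The functional `f ∘L L` is a combination of the elements of `s`, on which `ξ` has the
    -- prescribed values. Hence `f a ≤ ‖ξ‖ ‖f ∘L L‖ ≤ c`, against the separation.
    have : f a = ξ (f ∘L L) := by
      rw [hrep, hfL, map_sum]
      exact Finset.sum_congr rfl fun i _ => by simp [a, mul_comm]
    have h3 := (Real.le_norm_self (ξ (f ∘L L))).trans (ξ.le_opNorm _)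
    have h4 : ‖ξ‖ * ‖f ∘L L‖ ≤ 1 * c := mul_le_mul hξ hnorm (norm_nonneg _) zero_le_one
    linarith
  obtain ⟨_, ⟨x, hx, rfl⟩, hd⟩ := Metric.mem_closure_iff.1 ha ε hε
  refine ⟨x, by simpa using hx, fun f hf => ?_⟩
  have := (dist_pi_lt_iff hε).1 hd ⟨f, hf⟩
  rw [dist_comm, Real.dist_eq] at this
  exact this

end Bidual

/-! ### Second adjoints and the canonical embedding -/

section Conj

variable {X Y : Type u} [NormedAddCommGroup X] [NormedSpace ℝ X]
  [NormedAddCommGroup Y] [NormedSpace ℝ Y]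

@[simp] theorem conjOp_apply (T : X →L[ℝ] Y) (φ : StrongDual ℝ Y) : conjOp T φ = φ ∘L T := rfl

theorem conjOp_conjOp_apply (T : X →L[ℝ] Y) (ξ : StrongDual ℝ (StrongDual ℝ X))
    (φ : StrongDual ℝ Y) : conjOp (conjOp T) ξ φ = ξ (φ ∘L T) := rfl

theorem norm_conjOp_le (T : X →L[ℝ] Y) : ‖conjOp T‖ ≤ ‖T‖ :=
  ContinuousLinearMap.opNorm_le_bound _ (norm_nonneg _) fun φ => by
    rw [conjOp_apply, mul_comm]
    exact ContinuousLinearMap.opNorm_comp_le _ _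

theorem norm_inclusionInDoubleDual_apply (y : Y) :
    ‖NormedSpace.inclusionInDoubleDual ℝ Y y‖ = ‖y‖ :=
  (NormedSpace.inclusionInDoubleDualLi (E := Y) ℝ).norm_map y

theorem norm_le_of_inclusion_comp_eq {T : X →L[ℝ] Y} {S : StrongDual ℝ (StrongDual ℝ X) →L[ℝ] Y}
    (h : NormedSpace.inclusionInDoubleDual ℝ Y ∘L S = conjOp (conjOp T)) : ‖S‖ ≤ ‖T‖ :=
  ContinuousLinearMap.opNorm_le_bound _ (norm_nonneg _) fun ξ => by
    rw [← norm_inclusionInDoubleDual_apply, ← ContinuousLinearMap.comp_apply, h]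
    exact (ContinuousLinearMap.le_opNorm _ _).trans
      (mul_le_mul_of_nonneg_right ((norm_conjOp_le _).trans (norm_conjOp_le _)) (norm_nonneg _))

theorem isClosed_range_inclusionInDoubleDual [CompleteSpace Y] :
    IsClosed (Set.range (NormedSpace.inclusionInDoubleDual ℝ Y)) :=
  (NormedSpace.inclusionInDoubleDualLi (E := Y) ℝ).isometry.isClosedEmbedding.isClosed_range

/-- An operator into the bidual with values in the canonical copy of the space factors through
the canonical embedding. -/
theorem exists_inclusion_comp_eq (T : X →L[ℝ] StrongDual ℝ (StrongDual ℝ Y))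
    (h : ∀ ξ, T ξ ∈ Set.range (NormedSpace.inclusionInDoubleDual ℝ Y)) :
    ∃ S : X →L[ℝ] Y, NormedSpace.inclusionInDoubleDual ℝ Y ∘L S = T := by
  let e := (NormedSpace.inclusionInDoubleDualLi (E := Y) ℝ).equivRange
  refine ⟨(e.symm.toContinuousLinearEquiv : _ →L[ℝ] Y) ∘L T.codRestrict (NormedSpace.inclusionInDoubleDualLi (E := Y) ℝ).range h, ?_⟩
  ext1 ξ
  exact congrArg Subtype.val (e.apply_symm_apply ⟨T ξ, h ξ⟩)

/-- If `T` maps the unit ball into a weakly compact set `K`, then `T**` takes its values in the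
canonical copy of `Y` and maps the unit ball into `K`. -/
theorem exists_bidual_of_isCompact [CompleteSpace Y] (T : X →L[ℝ] Y) {K : Set Y}
    (hK : IsCompact (toWeakSpace ℝ Y '' K)) (hT : T '' Metric.closedBall 0 1 ⊆ K) :
    ∃ S : StrongDual ℝ (StrongDual ℝ X) →L[ℝ] Y,
      NormedSpace.inclusionInDoubleDual ℝ Y ∘L S = conjOp (conjOp T) ∧
        S '' Metric.closedBall 0 1 ⊆ K := by
  have key : ∀ ξ : StrongDual ℝ (StrongDual ℝ X), ‖ξ‖ ≤ 1 →
      ∃ y ∈ K, NormedSpace.inclusionInDoubleDual ℝ Y y = conjOp (conjOp T) ξ := by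
    intro ξ hξ
    have hcont : ∀ φ : StrongDual ℝ Y, Continuous fun w : WeakSpace ℝ Y =>
        φ ((toWeakSpace ℝ Y).symm w) := fun φ =>
      WeakBilin.eval_continuous (topDualPairing ℝ Y).flip φ
    -- Finite intersection property in the weakly compact `K`: finitely many conditions are met by
    -- some `T x` with `‖x‖ ≤ 1`, by Goldstine. A common point agrees with `T** ξ` on every
    -- functional.
    obtain ⟨_, ⟨y, hy, rfl⟩, hy'⟩ := hK.inter_iInter_nonempty
      (fun i : StrongDual ℝ Y × {ε : ℝ // 0 < ε} =>
        {w : WeakSpace ℝ Y | |i.1 ((toWeakSpace ℝ Y).symm w) - ξ (i.1 ∘L T)| ≤ i.2})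
      (fun i => isClosed_le (((hcont i.1).sub continuous_const).abs) continuous_const) (by
        classical
        intro s
        obtain ⟨ε, hε, hle⟩ : ∃ ε : ℝ, 0 < ε ∧ ∀ i ∈ s, ε ≤ i.2.1 := by
          induction s using Finset.induction_on with
          | empty => exact ⟨1, one_pos, by simp⟩
          | insert a s ha ih =>
            obtain ⟨ε, hε, h⟩ := ih
            refine ⟨min a.2.1 ε, lt_min a.2.2 hε, fun i hi => ?_⟩
            rcases Finset.mem_insert.1 hi with rfl | hi
            · exact min_le_left _ _
            · exact (min_le_right _ _).trans (h i hi)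
        obtain ⟨x, hx, hx'⟩ := exists_norm_le_one_forall_abs_sub_lt hξ
          (s.image fun i => i.1 ∘L T) hε
        refine ⟨toWeakSpace ℝ Y (T x), ⟨T x, hT ⟨x, by simpa using hx, rfl⟩, rfl⟩, ?_⟩
        simp only [Set.mem_iInter]
        intro i hi
        exact (hx' _ (Finset.mem_image_of_mem _ hi)).le.trans (hle i hi))
    refine ⟨y, hy, ?_⟩
    ext φ
    rw [NormedSpace.dual_def, conjOp_conjOp_apply]
    refine eq_of_abs_sub_nonpos (le_of_forall_pos_le_add fun ε hε => ?_)
    have := Set.mem_iInter.1 hy' (φ, ⟨ε, hε⟩)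
    simpa using this
  obtain ⟨S, hS⟩ := exists_inclusion_comp_eq (conjOp (conjOp T)) fun ξ => by
    obtain ⟨c, hc, hcξ⟩ : ∃ c : ℝ, 0 < c ∧ ‖c⁻¹ • ξ‖ ≤ 1 := by
      refine ⟨‖ξ‖ + 1, by positivity, ?_⟩
      rw [norm_smul, norm_inv, Real.norm_of_nonneg (by positivity), inv_mul_le_iff₀ (by positivity)]
      linarith
    obtain ⟨y, -, hy⟩ := key _ hcξ
    refine ⟨c • y, ?_⟩
    rw [map_smul, hy, map_smul, smul_inv_smul₀ hc.ne']
  refine ⟨S, hS, ?_⟩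
  rintro _ ⟨ξ, hξ, rfl⟩
  obtain ⟨y, hy, hy'⟩ := key ξ (mem_closedBall_zero_iff.1 hξ)
  rw [← hS] at hy'
  have hyS : y = S ξ := (NormedSpace.inclusionInDoubleDualLi (E := Y) ℝ).injective hy'
  exact hyS ▸ hy

end Conj

/-! ### Operators and images of the unit ball -/

section Basic

variable {X Y : Type*} [NormedAddCommGroup X] [NormedSpace ℝ X]
  [NormedAddCommGroup Y] [NormedSpace ℝ Y]

theorem exists_pos_norm_inv_smul_le_one (x : X) : ∃ c : ℝ, 0 < c ∧ ‖c⁻¹ • x‖ ≤ 1 := by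
  refine ⟨‖x‖ + 1, by positivity, ?_⟩
  rw [norm_smul, norm_inv, Real.norm_of_nonneg (by positivity), inv_mul_le_iff₀ (by positivity)]
  linarith

theorem range_le_of_image_closedBall_subset (T : X →L[ℝ] Y) {V : Submodule ℝ Y}
    (h : T '' Metric.closedBall 0 1 ⊆ V) : T.toLinearMap.range ≤ V := by
  rintro _ ⟨x, rfl⟩
  obtain ⟨c, hc, hcx⟩ := exists_pos_norm_inv_smul_le_one x
  have := V.smul_mem c (h ⟨c⁻¹ • x, by simpa using hcx, rfl⟩)
  rwa [map_smul, smul_inv_smul₀ hc.ne'] at this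

/-- Dividing by `‖S‖ + 1` brings `S w` back into the unit ball; the `+ 1` covers `S = 0`. -/
theorem image_closedBall_comp_subset {W Z : Type*} [NormedAddCommGroup W] [NormedSpace ℝ W]
    [NormedAddCommGroup Z] [NormedSpace ℝ Z] (S : W →L[ℝ] X) (T : X →L[ℝ] Y) (R : Y →L[ℝ] Z)
    {K : Set Y} (hT : T '' Metric.closedBall 0 1 ⊆ K) :
    (R ∘L T ∘L S) '' Metric.closedBall 0 1 ⊆ (fun y => (‖S‖ + 1) • R y) '' K := by
  rintro _ ⟨w, hw, rfl⟩
  have hpos : 0 < ‖S‖ + 1 := by positivity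
  refine ⟨T ((‖S‖ + 1)⁻¹ • S w), hT ⟨_, ?_, rfl⟩, ?_⟩
  · rw [mem_closedBall_zero_iff] at hw ⊢
    rw [norm_smul, norm_inv, Real.norm_of_nonneg hpos.le, inv_mul_le_iff₀ hpos]
    calc ‖S w‖ ≤ ‖S‖ * ‖w‖ := S.le_opNorm w
      _ ≤ ‖S‖ * 1 := by gcongr
      _ ≤ (‖S‖ + 1) * 1 := by gcongr; linarith
  · simp only [map_smul, ContinuousLinearMap.comp_apply]
    rw [smul_inv_smul₀ hpos.ne']

theorem isCompactOperator_of_finiteDimensional_range (T : X →L[ℝ] Y)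
    [FiniteDimensional ℝ T.toLinearMap.range] : IsCompactOperator T := by
  let T' : X →L[ℝ] T.toLinearMap.range :=
    T.codRestrict T.toLinearMap.range fun x => ⟨x, rfl⟩
  have : ProperSpace T.toLinearMap.range := FiniteDimensional.proper ℝ _
  have h : IsCompactOperator T' := isCompactOperator_of_locallyCompactSpace_dom T'
  exact h.clm_comp T.toLinearMap.range.subtypeL

theorem exists_isCompact_image_smulRight_subset (φ : StrongDual ℝ X) (y : Y) :
    ∃ K, IsCompact K ∧ (φ.smulRight y) '' Metric.closedBall 0 1 ⊆ K := by
  refine ⟨(fun t : ℝ => t • y) '' Metric.closedBall 0 ‖φ‖,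
    (isCompact_closedBall _ _).image (by fun_prop), ?_⟩
  rintro _ ⟨x, hx, rfl⟩
  refine ⟨φ x, ?_, rfl⟩
  rw [mem_closedBall_zero_iff] at hx ⊢
  exact (φ.le_opNorm x).trans (mul_le_of_le_one_right (norm_nonneg _) hx)

theorem isCompact_image_toWeakSpace {K : Set Y} (hK : IsCompact K) :
    IsCompact (toWeakSpace ℝ Y '' K) :=
  hK.image (toWeakSpaceCLM ℝ Y).continuous

end Basic

/-! ### Finite rank operators -/

theorem isOperatorIdeal_finiteRankOps : IsOperatorIdeal finiteRankOps.{u} where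
  zero_mem X Y _ _ _ _ _ _ := by
    change FiniteDimensional ℝ (LinearMap.range (0 : X →ₗ[ℝ] Y))
    rw [LinearMap.range_zero]
    infer_instance
  add_mem X Y _ _ _ _ _ _ S T hS hT := by
    change FiniteDimensional ℝ (LinearMap.range ((S : X →ₗ[ℝ] Y) + (T : X →ₗ[ℝ] Y)))
    have : FiniteDimensional ℝ (LinearMap.range (S : X →ₗ[ℝ] Y)) := hS
    have : FiniteDimensional ℝ (LinearMap.range (T : X →ₗ[ℝ] Y)) := hT
    exact Submodule.finiteDimensional_of_le (LinearMap.range_add_le _ _)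
  smul_mem X Y _ _ _ _ _ _ c T hT := by
    have : FiniteDimensional ℝ (LinearMap.range (T : X →ₗ[ℝ] Y)) := hT
    refine Submodule.finiteDimensional_of_le (S₂ := LinearMap.range (T : X →ₗ[ℝ] Y)) ?_
    rintro _ ⟨x, rfl⟩
    exact Submodule.smul_mem _ c ⟨x, rfl⟩
  rankOne_mem X Y _ _ _ _ _ _ φ y := by
    refine Submodule.finiteDimensional_of_le (S₂ := Submodule.span ℝ {y}) ?_
    rintro _ ⟨x, rfl⟩
    exact Submodule.smul_mem _ (φ x) (Submodule.mem_span_singleton_self y)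
  comp_mem W X Y Z _ _ _ _ _ _ _ _ _ _ _ _ S T R hT := by
    have : FiniteDimensional ℝ (LinearMap.range (T : X →ₗ[ℝ] Y)) := hT
    refine Submodule.finiteDimensional_of_le
      (S₂ := (LinearMap.range (T : X →ₗ[ℝ] Y)).map (R : Y →ₗ[ℝ] Z)) ?_
    rintro _ ⟨x, rfl⟩
    exact ⟨T (S x), ⟨S x, rfl⟩, rfl⟩

section

variable (Z : Type u) [NormedAddCommGroup Z] [NormedSpace ℝ Z] [CompleteSpace Z]

/-- The range of `T` is finite-dimensional, hence closed, so it contains the compact closure of the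
image of the ball and with it the range of the operator representing `T**`. -/
theorem bidualCondition_finiteRankOps : BidualCondition finiteRankOps Z := by
  intro T hT
  have : FiniteDimensional ℝ (LinearMap.range (T : Z →ₗ[ℝ] Z)) := hT
  have hK : IsCompact (closure (T '' Metric.closedBall 0 1)) :=
    (isCompactOperator_of_finiteDimensional_range T).isCompact_closure_image_closedBall
      (f := T.toLinearMap) 1
  obtain ⟨S, hS, hSK⟩ := exists_bidual_of_isCompact T (isCompact_image_toWeakSpace hK)
    subset_closure
  refine ⟨S, ?_, hS⟩
  refine Submodule.finiteDimensional_of_le (S₂ := LinearMap.range (T : Z →ₗ[ℝ] Z)) ?_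
  refine range_le_of_image_closedBall_subset S (hSK.trans ?_)
  refine closure_minimal ?_ (Submodule.closed_of_finiteDimensional _)
  rintro _ ⟨x, -, rfl⟩
  exact ⟨x, rfl⟩

/-! ### Compact operators -/

theorem isOperatorIdeal_compactOps : IsOperatorIdeal compactOps.{u} where
  zero_mem _ _ _ _ _ _ _ _ := isCompactOperator_zero
  add_mem _ _ _ _ _ _ _ _ _ _ hS hT := IsCompactOperator.add hS hT
  smul_mem _ _ _ _ _ _ _ _ c _ hT := IsCompactOperator.smul hT c
  rankOne_mem _ _ _ _ _ _ _ _ φ y :=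
    (isCompactOperator_iff_image_closedBall_subset_compact
      (φ.smulRight y).toLinearMap one_pos).2 (exists_isCompact_image_smulRight_subset φ y)
  comp_mem _ _ _ _ _ _ _ _ _ _ _ _ _ _ _ _ S _ R hT :=
    (IsCompactOperator.comp_clm hT S).clm_comp R

theorem bidualCondition_compactOps : BidualCondition compactOps Z := by
  intro T hT
  have hK : IsCompact (closure (T '' Metric.closedBall 0 1)) :=
    IsCompactOperator.isCompact_closure_image_closedBall (f := T.toLinearMap) hT 1
  obtain ⟨S, hS, hSK⟩ := exists_bidual_of_isCompact T (isCompact_image_toWeakSpace hK)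
    subset_closure
  exact ⟨S, (isCompactOperator_iff_image_closedBall_subset_compact S.toLinearMap one_pos).2
    ⟨_, hK, hSK⟩, hS⟩

end

/-! ### Weakly compact operators -/

/-- Working with a weakly compact superset avoids closures: such sets are stable under sums and
weakly continuous images. -/
theorem mem_weaklyCompactOps_iff {X Y : Type u} [NormedAddCommGroup X] [NormedSpace ℝ X]
    [CompleteSpace X] [NormedAddCommGroup Y] [NormedSpace ℝ Y] [CompleteSpace Y] {T : X →L[ℝ] Y} :
    T ∈ weaklyCompactOps X Y ↔
      ∃ K : Set Y, IsCompact (toWeakSpace ℝ Y '' K) ∧ T '' Metric.closedBall 0 1 ⊆ K := by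
  constructor
  · intro h
    refine ⟨toWeakSpace ℝ Y ⁻¹' closure (toWeakSpace ℝ Y '' (T '' Metric.closedBall 0 1)), ?_, ?_⟩
    · rwa [Set.image_preimage_eq _ (toWeakSpace ℝ Y).surjective]
    · intro y hy
      have : toWeakSpace ℝ Y y ∈ toWeakSpace ℝ Y '' (T '' Metric.closedBall 0 1) := ⟨y, hy, rfl⟩
      exact Set.mem_preimage.2 (subset_closure this)
  · rintro ⟨K, hK, hT⟩
    exact hK.closure_of_subset (Set.image_mono hT)

theorem isOperatorIdeal_weaklyCompactOps : IsOperatorIdeal weaklyCompactOps.{u} := by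
  have hcomp : ∀ (W X Y Z : Type u) [NormedAddCommGroup W] [NormedSpace ℝ W] [CompleteSpace W]
      [NormedAddCommGroup X] [NormedSpace ℝ X] [CompleteSpace X]
      [NormedAddCommGroup Y] [NormedSpace ℝ Y] [CompleteSpace Y]
      [NormedAddCommGroup Z] [NormedSpace ℝ Z] [CompleteSpace Z]
      (S : W →L[ℝ] X) (T : X →L[ℝ] Y) (R : Y →L[ℝ] Z),
      T ∈ weaklyCompactOps X Y → R ∘L T ∘L S ∈ weaklyCompactOps W Z := by
    intro W X Y Z _ _ _ _ _ _ _ _ _ _ _ _ S T R hT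
    obtain ⟨K, hK, hTK⟩ := mem_weaklyCompactOps_iff.1 hT
    refine mem_weaklyCompactOps_iff.2 ⟨_, ?_, image_closedBall_comp_subset S T R hTK⟩
    rw [Set.image_image]
    have := hK.image (WeakSpace.map ((‖S‖ + 1) • R)).continuous
    rwa [Set.image_image] at this
  refine ⟨?_, ?_, ?_, ?_, hcomp⟩
  · intro X Y _ _ _ _ _ _
    refine mem_weaklyCompactOps_iff.2 ⟨{0}, by simp, ?_⟩
    rintro _ ⟨x, -, rfl⟩
    rfl
  · intro X Y _ _ _ _ _ _ S T hS hT
    obtain ⟨K, hK, hSK⟩ := mem_weaklyCompactOps_iff.1 hS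
    obtain ⟨L, hL, hTL⟩ := mem_weaklyCompactOps_iff.1 hT
    refine mem_weaklyCompactOps_iff.2
      ⟨Set.image2 (fun a b => a + b) K L, ?_, ?_⟩
    · rw [Set.image_image2_distrib (g := toWeakSpace ℝ Y)
        (f' := fun a b : WeakSpace ℝ Y => a + b) fun a b => map_add _ a b]
      exact hK.add hL
    · rintro _ ⟨x, hx, rfl⟩
      exact ⟨S x, hSK ⟨x, hx, rfl⟩, T x, hTL ⟨x, hx, rfl⟩, rfl⟩
  · intro X Y _ _ _ _ _ _ c T hT
    exact hcomp X X Y Y (ContinuousLinearMap.id ℝ X) T (c • ContinuousLinearMap.id ℝ Y) hT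
  · intro X Y _ _ _ _ _ _ φ y
    obtain ⟨K, hK, h⟩ := exists_isCompact_image_smulRight_subset φ y
    exact mem_weaklyCompactOps_iff.2 ⟨K, isCompact_image_toWeakSpace hK, h⟩

theorem bidualCondition_weaklyCompactOps (Z : Type u) [NormedAddCommGroup Z] [NormedSpace ℝ Z]
    [CompleteSpace Z] : BidualCondition weaklyCompactOps Z := by
  intro T hT
  obtain ⟨K, hK, hTK⟩ := mem_weaklyCompactOps_iff.1 hT
  obtain ⟨S, hS, hSK⟩ := exists_bidual_of_isCompact T hK hTK
  exact ⟨S, mem_weaklyCompactOps_iff.2 ⟨K, hK, hSK⟩, hS⟩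

/-! ### `p`-compact operators -/

/-- The closed unit ball of `ℓ_q`, as a set of sequences. -/
def lpUnitBall (q : ENNReal) : Set (ℕ → ℝ) :=
  {a | ∃ b : lp (fun _ : ℕ => ℝ) q, ‖b‖ ≤ 1 ∧ ⇑b = a}

theorem mem_lpUnitBall_top {a : ℕ → ℝ} : a ∈ lpUnitBall ⊤ ↔ ∀ n, |a n| ≤ 1 := by
  constructor
  · rintro ⟨b, hb, rfl⟩ n
    exact (lp.norm_apply_le_norm ENNReal.top_ne_zero b n).trans hb
  · intro h
    refine ⟨⟨a, memℓp_infty ⟨1, ?_⟩⟩, lp.norm_le_of_forall_le zero_le_one h, rfl⟩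
    rintro _ ⟨n, rfl⟩
    exact h n

theorem mem_lpUnitBall_iff {q : ENNReal} (hq : 0 < q.toReal) {a : ℕ → ℝ} :
    a ∈ lpUnitBall q ↔ ∀ s : Finset ℕ, ∑ n ∈ s, |a n| ^ q.toReal ≤ 1 := by
  constructor
  · rintro ⟨b, hb, rfl⟩ s
    refine (lp.sum_rpow_le_norm_rpow hq b s).trans ?_
    exact Real.rpow_le_one (lp.norm_nonneg' _) hb hq.le
  · intro h
    refine ⟨⟨a, memℓp_gen' (C := 1) h⟩, ?_, rfl⟩
    refine lp.norm_le_of_forall_sum_le hq zero_le_one fun s => ?_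
    rw [Real.one_rpow]
    exact h s

theorem abs_le_one_of_mem_lpUnitBall {q : ENNReal} (hq : 1 ≤ q) {a : ℕ → ℝ}
    (ha : a ∈ lpUnitBall q) (n : ℕ) : |a n| ≤ 1 := by
  obtain ⟨b, hb, rfl⟩ := ha
  exact (lp.norm_apply_le_norm (zero_lt_one.trans_le hq).ne' b n).trans hb

/-- Compactness is for pointwise convergence: the defining inequalities involve finitely many
coordinates each, so they cut out a closed subset of `[-1, 1]^ℕ`. -/
theorem isCompact_lpUnitBall {q : ENNReal} (hq : 1 ≤ q) : IsCompact (lpUnitBall q) := by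
  have hK : IsCompact (Set.univ.pi fun _ : ℕ => Set.Icc (-1 : ℝ) 1) :=
    isCompact_univ_pi fun _ => isCompact_Icc
  refine hK.of_isClosed_subset ?_ fun a ha n _ => abs_le.1 (abs_le_one_of_mem_lpUnitBall hq ha n)
  by_cases hq' : q = ⊤
  · have : lpUnitBall q = ⋂ n, {a : ℕ → ℝ | |a n| ≤ 1} := by
      ext a
      rw [hq', mem_lpUnitBall_top, Set.mem_iInter]
      rfl
    rw [this]
    exact isClosed_iInter fun n => isClosed_le (continuous_apply n).abs continuous_const
  · have hpos : 0 < q.toReal := ENNReal.toReal_pos (zero_lt_one.trans_le hq).ne' hq'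
    have : lpUnitBall q = ⋂ s : Finset ℕ, {a : ℕ → ℝ | ∑ n ∈ s, |a n| ^ q.toReal ≤ 1} := by
      ext a
      rw [mem_lpUnitBall_iff hpos, Set.mem_iInter]
      rfl
    rw [this]
    refine isClosed_iInter fun s => isClosed_le (continuous_finsetSum _ fun n _ => ?_)
      continuous_const
    exact (continuous_apply n).abs.rpow_const fun _ => Or.inr hpos.le

theorem single_mem_lpUnitBall {q : ENNReal} (hq : 1 ≤ q) {t : ℝ} (ht : |t| ≤ 1) :
    Pi.single 0 t ∈ lpUnitBall q := by
  refine ⟨lp.single q 0 t, ?_, by ext; simp⟩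
  rw [lp.norm_single (zero_lt_one.trans_le hq)]
  exact ht

/-- Interlacing two elements of the unit ball with weight `1 / 2`. -/
theorem interlace_mem_lpUnitBall {q : ENNReal} (hq : 1 ≤ q) {a b : ℕ → ℝ} (ha : a ∈ lpUnitBall q)
    (hb : b ∈ lpUnitBall q) :
    (fun n => (1 / 2 : ℝ) * Sum.elim a b (Equiv.natSumNatEquivNat.symm n)) ∈ lpUnitBall q := by
  by_cases hq' : q = ⊤
  · subst hq'
    rw [mem_lpUnitBall_top] at *
    intro n
    rw [abs_mul, abs_of_pos (by norm_num : (0 : ℝ) < 1 / 2)]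
    rcases Equiv.natSumNatEquivNat.symm n with k | k
    · have := ha k
      simp only [Sum.elim_inl]
      linarith
    · have := hb k
      simp only [Sum.elim_inr]
      linarith
  · have hpos : 0 < q.toReal := ENNReal.toReal_pos (zero_lt_one.trans_le hq).ne' hq'
    have h1 : 1 ≤ q.toReal := by
      rw [← ENNReal.toReal_one]
      exact ENNReal.toReal_mono hq' hq
    rw [mem_lpUnitBall_iff hpos] at *
    intro s
    -- This is where `q ≥ 1` enters: two interlaced sums of size at most `1` are scaled by at most
    -- `1 / 2`.
    have hle : (1 / 2 : ℝ) ^ q.toReal ≤ 1 / 2 := by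
      simpa using Real.rpow_le_rpow_of_exponent_ge (by norm_num : (0 : ℝ) < 1 / 2) (by norm_num) h1
    calc ∑ n ∈ s, |(1 / 2 : ℝ) * Sum.elim a b (Equiv.natSumNatEquivNat.symm n)| ^ q.toReal
        = (1 / 2 : ℝ) ^ q.toReal * ∑ i ∈ s.map Equiv.natSumNatEquivNat.symm.toEmbedding,
            |Sum.elim a b i| ^ q.toReal := by
          rw [Finset.mul_sum, Finset.sum_map]
          refine Finset.sum_congr rfl fun n _ => ?_
          rw [abs_mul, Real.mul_rpow (abs_nonneg _) (abs_nonneg _),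
            abs_of_pos (by norm_num : (0 : ℝ) < 1 / 2)]
          rfl
      _ ≤ (1 / 2) * (1 + 1) := by
          rw [Finset.sum_sum_eq_sum_toLeft_add_sum_toRight]
          refine mul_le_mul hle (add_le_add (ha _) (hb _)) ?_ (by norm_num)
          exact add_nonneg (Finset.sum_nonneg fun _ _ => Real.rpow_nonneg (abs_nonneg _) _)
            (Finset.sum_nonneg fun _ _ => Real.rpow_nonneg (abs_nonneg _) _)
      _ = 1 := by norm_num

theorem one_le_conjExponent (p : ENNReal) : 1 ≤ ENNReal.conjExponent p := le_self_add

section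

variable {Y : Type u} [NormedAddCommGroup Y] [NormedSpace ℝ Y]

theorem isRelPCompact_iff {p : ℝ} {K : Set Y} : IsRelPCompact p K ↔
    ∃ x : ℕ → Y, Summable (fun n => ‖x n‖ ^ p) ∧ ∀ y ∈ K,
      ∃ a ∈ lpUnitBall (ENNReal.conjExponent (ENNReal.ofReal p)),
        HasSum (fun n => a n • x n) y := by
  refine exists_congr fun x => and_congr_right fun _ => forall₂_congr fun y _ => ?_
  constructor
  · rintro ⟨a, ha, h⟩
    exact ⟨a, ⟨a, ha, rfl⟩, h⟩
  · rintro ⟨_, ⟨a, ha, rfl⟩, h⟩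
    exact ⟨a, ha, h⟩

/-- Hölder's inequality for elements of the unit ball of `ℓ_q`. -/
theorem norm_sum_smul_le_of_mem_lpUnitBall {p : ℝ} (hp : 1 ≤ p) {a : ℕ → ℝ}
    (ha : a ∈ lpUnitBall (ENNReal.conjExponent (ENNReal.ofReal p))) (x : ℕ → Y) (s : Finset ℕ) :
    ‖∑ n ∈ s, a n • x n‖ ≤ (∑ n ∈ s, ‖x n‖ ^ p) ^ (1 / p) := by
  have h0 : ‖∑ n ∈ s, a n • x n‖ ≤ ∑ n ∈ s, |a n| * ‖x n‖ :=
    (norm_sum_le _ _).trans (Finset.sum_le_sum fun n _ => (norm_smul _ _).le)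
  refine h0.trans ?_
  rcases hp.eq_or_lt with rfl | hp'
  · simp only [Real.rpow_one, div_one]
    exact Finset.sum_le_sum fun n _ => mul_le_of_le_one_left (norm_nonneg _)
      (abs_le_one_of_mem_lpUnitBall (one_le_conjExponent _) ha n)
  · have hpt : (ENNReal.ofReal p).toReal = p := ENNReal.toReal_ofReal (by linarith)
    have hle : 1 ≤ ENNReal.ofReal p := by simpa using hp
    have hc := ENNReal.HolderConjugate.conjExponent hle
    have hpq := ENNReal.HolderConjugate.toReal (p := ENNReal.ofReal p)
      (q := ENNReal.conjExponent (ENNReal.ofReal p)) (by rwa [hpt])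
    rw [hpt] at hpq
    have h := Real.inner_le_Lp_mul_Lq s (fun n => ‖x n‖) (fun n => |a n|) hpq
    simp only [abs_norm, abs_abs] at h
    calc ∑ n ∈ s, |a n| * ‖x n‖ = ∑ n ∈ s, ‖x n‖ * |a n| :=
          Finset.sum_congr rfl fun n _ => mul_comm _ _
      _ ≤ _ := h
      _ ≤ (∑ n ∈ s, ‖x n‖ ^ p) ^ (1 / p) * 1 := by
          refine mul_le_mul_of_nonneg_left ?_
            (Real.rpow_nonneg (Finset.sum_nonneg fun _ _ => Real.rpow_nonneg (norm_nonneg _) _) _)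
          refine Real.rpow_le_one
            (Finset.sum_nonneg fun _ _ => Real.rpow_nonneg (abs_nonneg _) _)
            ((mem_lpUnitBall_iff hpq.symm.pos).1 ha s) (one_div_nonneg.2 hpq.symm.nonneg)
      _ = _ := mul_one _

/-- The set of all `∑ aₙ xₙ` with `‖a‖_q ≤ 1` is compact. -/
theorem isCompact_hasSum_smul [CompleteSpace Y] {p : ℝ} (hp : 1 ≤ p) {x : ℕ → Y}
    (hx : Summable fun n => ‖x n‖ ^ p) :
    IsCompact {y | ∃ a ∈ lpUnitBall (ENNReal.conjExponent (ENNReal.ofReal p)),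
      HasSum (fun n => a n • x n) y} := by
  -- By Hölder the tails are small uniformly in `a`. This gives both summability and the continuity
  -- of `a ↦ ∑ aₙ xₙ` for pointwise convergence, so the set is a continuous image of a compact one.
  have hvan : ∀ ε : ℝ, 0 < ε → ∃ s : Finset ℕ, ∀ a ∈
      lpUnitBall (ENNReal.conjExponent (ENNReal.ofReal p)), ∀ t, Disjoint t s →
        ‖∑ n ∈ t, a n • x n‖ < ε := by
    intro ε hε
    obtain ⟨s, hs⟩ := summable_iff_vanishing_norm.1 hx (ε ^ p) (Real.rpow_pos_of_pos hε p)
    refine ⟨s, fun a ha t ht => (norm_sum_smul_le_of_mem_lpUnitBall hp ha x t).trans_lt ?_⟩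
    have h := (Real.le_norm_self _).trans_lt (hs t ht)
    rw [one_div, Real.rpow_inv_lt_iff_of_pos
      (Finset.sum_nonneg fun _ _ => Real.rpow_nonneg (norm_nonneg _) _) hε.le (by linarith)]
    exact h
  have hsum : ∀ a ∈ lpUnitBall (ENNReal.conjExponent (ENNReal.ofReal p)),
      Summable fun n => a n • x n := fun a ha =>
    summable_iff_vanishing_norm.2 fun ε hε =>
      let ⟨s, hs⟩ := hvan ε hε
      ⟨s, hs a ha⟩
  have hcont : ContinuousOn (fun a : ℕ → ℝ => ∑' n, a n • x n)
      (lpUnitBall (ENNReal.conjExponent (ENNReal.ofReal p))) := by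
    refine TendstoUniformlyOn.continuousOn (p := atTop)
      (F := fun (s : Finset ℕ) (a : ℕ → ℝ) => ∑ n ∈ s, a n • x n) ?_
      (Frequently.of_forall fun s => (continuous_finsetSum _ fun n _ =>
        (continuous_apply n).smul continuous_const).continuousOn)
    rw [Metric.tendstoUniformlyOn_iff]
    intro ε hε
    obtain ⟨s, hs⟩ := hvan (ε / 2) (half_pos hε)
    filter_upwards [eventually_ge_atTop s] with t ht a ha
    refine lt_of_le_of_lt ?_ (half_lt_self hε)
    refine le_of_tendsto ((hsum a ha).hasSum.dist tendsto_const_nhds) ?_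
    filter_upwards [eventually_ge_atTop t] with r hr
    rw [dist_eq_norm, ← Finset.sum_sdiff_eq_sub hr]
    exact (hs a ha _ (Finset.disjoint_left.2 fun n hn hn' =>
      (Finset.mem_sdiff.1 hn).2 (ht hn'))).le
  convert (isCompact_lpUnitBall (one_le_conjExponent (ENNReal.ofReal p))).image_of_continuousOn
    hcont using 1
  ext y
  constructor
  · rintro ⟨a, ha, h⟩
    exact ⟨a, ha, h.tsum_eq⟩
  · rintro ⟨a, ha, rfl⟩
    exact ⟨a, ha, (hsum a ha).hasSum⟩

end

theorem isOperatorIdeal_pCompactOps {p : ℝ} (hp : 1 ≤ p) : IsOperatorIdeal (pCompactOps.{u} p) := by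
  have hp0 : p ≠ 0 := by linarith
  have hcomp : ∀ (W X Y Z : Type u) [NormedAddCommGroup W] [NormedSpace ℝ W] [CompleteSpace W]
      [NormedAddCommGroup X] [NormedSpace ℝ X] [CompleteSpace X]
      [NormedAddCommGroup Y] [NormedSpace ℝ Y] [CompleteSpace Y]
      [NormedAddCommGroup Z] [NormedSpace ℝ Z] [CompleteSpace Z]
      (S : W →L[ℝ] X) (T : X →L[ℝ] Y) (R : Y →L[ℝ] Z),
      T ∈ pCompactOps p X Y → R ∘L T ∘L S ∈ pCompactOps p W Z := by
    intro W X Y Z _ _ _ _ _ _ _ _ _ _ _ _ S T R hT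
    obtain ⟨y, hy, hTy⟩ := isRelPCompact_iff.1 hT
    set R' : Y →L[ℝ] Z := (‖S‖ + 1) • R with hR'
    refine isRelPCompact_iff.2 ⟨fun n => R' (y n), ?_, ?_⟩
    · refine Summable.of_nonneg_of_le (fun n => Real.rpow_nonneg (norm_nonneg _) _) (fun n => ?_)
        (hy.mul_left (‖R'‖ ^ p))
      rw [← Real.mul_rpow (norm_nonneg _) (norm_nonneg _)]
      exact Real.rpow_le_rpow (norm_nonneg _) (R'.le_opNorm _) (by linarith)
    · intro z hz
      obtain ⟨w, hw, rfl⟩ := image_closedBall_comp_subset S T R subset_rfl hz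
      obtain ⟨a, ha, h⟩ := hTy w hw
      refine ⟨a, ha, ?_⟩
      have := R'.hasSum h
      simp only [map_smul] at this
      exact this
  refine ⟨?_, ?_, ?_, ?_, hcomp⟩
  · intro X Y _ _ _ _ _ _
    refine isRelPCompact_iff.2 ⟨0, by simp [Real.zero_rpow hp0], ?_⟩
    rintro _ ⟨x, -, rfl⟩
    refine ⟨Pi.single 0 0, single_mem_lpUnitBall (one_le_conjExponent _) (by simp), ?_⟩
    simp
  · intro X Y _ _ _ _ _ _ S T hS hT
    obtain ⟨x, hx, hSx⟩ := isRelPCompact_iff.1 hS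
    obtain ⟨y, hy, hTy⟩ := isRelPCompact_iff.1 hT
    -- The factor `2` compensates the weight `1 / 2` on the interlaced coefficients.
    refine isRelPCompact_iff.2
      ⟨fun n => (2 : ℝ) • Sum.elim x y (Equiv.natSumNatEquivNat.symm n), ?_, ?_⟩
    · refine (Equiv.natSumNatEquivNat.symm.summable_iff
        (f := fun i => ‖(2 : ℝ) • Sum.elim x y i‖ ^ p)).2 ?_
      have h : ∀ z : Y, ‖(2 : ℝ) • z‖ ^ p = 2 ^ p * ‖z‖ ^ p := fun z => by
        rw [norm_smul, Real.mul_rpow (norm_nonneg _) (norm_nonneg _), Real.norm_ofNat]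
      simp only [h]
      refine Summable.mul_left _ ?_
      exact (hx.hasSum.sum (f := fun i => ‖Sum.elim x y i‖ ^ p) hy.hasSum).summable
    · rintro _ ⟨z, hz, rfl⟩
      obtain ⟨a, ha, hsa⟩ := hSx _ ⟨z, hz, rfl⟩
      obtain ⟨b, hb, hsb⟩ := hTy _ ⟨z, hz, rfl⟩
      refine ⟨_, interlace_mem_lpUnitBall (one_le_conjExponent _) ha hb, ?_⟩
      have hsum : HasSum (fun i => Sum.elim a b i • Sum.elim x y i) (S z + T z) :=
        HasSum.sum (f := fun i => Sum.elim a b i • Sum.elim x y i) hsa hsb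
      rw [_root_.add_apply]
      convert Equiv.natSumNatEquivNat.symm.hasSum_iff.2 hsum using 2 with n
      rw [smul_smul, mul_right_comm]
      norm_num
  · intro X Y _ _ _ _ _ _ c T hT
    exact hcomp X X Y Y (ContinuousLinearMap.id ℝ X) T (c • ContinuousLinearMap.id ℝ Y) hT
  · intro X Y _ _ _ _ _ _ φ y
    have hpos : 0 < ‖φ‖ + 1 := by positivity
    refine isRelPCompact_iff.2 ⟨Pi.single 0 ((‖φ‖ + 1) • y), ?_, ?_⟩
    · refine summable_of_ne_finset_zero (s := {0}) fun n hn => ?_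
      rw [Pi.single_eq_of_ne (by simpa using hn), norm_zero, Real.zero_rpow hp0]
    · rintro _ ⟨x, hx, rfl⟩
      refine ⟨Pi.single 0 ((‖φ‖ + 1)⁻¹ * φ x),
        single_mem_lpUnitBall (one_le_conjExponent _) ?_, ?_⟩
      · rw [abs_mul, abs_inv, abs_of_pos hpos, inv_mul_le_iff₀ hpos, mul_one]
        rw [mem_closedBall_zero_iff] at hx
        have := (φ.le_opNorm x).trans (mul_le_of_le_one_right (norm_nonneg _) hx)
        rw [Real.norm_eq_abs] at this
        linarith
      · convert hasSum_single (f := fun n => (Pi.single 0 ((‖φ‖ + 1)⁻¹ * φ x) : ℕ → ℝ) n •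
          (Pi.single 0 ((‖φ‖ + 1) • y) : ℕ → Y) n) 0 ?_ using 1
        · simp only [Pi.single_eq_same, smul_smul]
          rw [mul_right_comm, inv_mul_cancel₀ hpos.ne', one_mul]
          rfl
        · intro n hn
          simp [hn]

/-- The set of all `∑ aₙ xₙ` is itself compact, so the sequence witnessing `p`-compactness of `T`
also serves for the bidual operator. -/
theorem bidualCondition_pCompactOps {p : ℝ} (hp : 1 ≤ p) (Z : Type u) [NormedAddCommGroup Z]
    [NormedSpace ℝ Z] [CompleteSpace Z] : BidualCondition (pCompactOps p) Z := by
  intro T hT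
  obtain ⟨x, hx, hTx⟩ := isRelPCompact_iff.1 hT
  obtain ⟨S, hS, hSK⟩ := exists_bidual_of_isCompact T
    (isCompact_image_toWeakSpace (isCompact_hasSum_smul hp hx)) hTx
  exact ⟨S, isRelPCompact_iff.2 ⟨x, hx, hSK⟩, hS⟩

/-! ### `p`-summing operators -/

/-- The `ℓ_p`-norm of a finite sequence of real numbers. -/
noncomputable def finPNorm (p : ℝ) {n : ℕ} (a : Fin n → ℝ) : ℝ := (∑ i, |a i| ^ p) ^ (1 / p)

section finPNorm

variable {p : ℝ} {n : ℕ}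

theorem sum_abs_rpow_nonneg (a : Fin n → ℝ) : 0 ≤ ∑ i, |a i| ^ p :=
  Finset.sum_nonneg fun _ _ => Real.rpow_nonneg (abs_nonneg _) _

theorem finPNorm_nonneg (a : Fin n → ℝ) : 0 ≤ finPNorm p a :=
  Real.rpow_nonneg (sum_abs_rpow_nonneg a) _

theorem finPNorm_mono (hp : 1 ≤ p) {a b : Fin n → ℝ} (h : ∀ i, |a i| ≤ |b i|) :
    finPNorm p a ≤ finPNorm p b :=
  Real.rpow_le_rpow (sum_abs_rpow_nonneg a)
    (Finset.sum_le_sum fun i _ => Real.rpow_le_rpow (abs_nonneg _) (h i) (by linarith))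
    (one_div_nonneg.2 (by linarith))

theorem finPNorm_const_mul (hp : 1 ≤ p) (c : ℝ) (a : Fin n → ℝ) :
    finPNorm p (fun i => c * a i) = |c| * finPNorm p a := by
  have hp0 : p ≠ 0 := by linarith
  simp only [finPNorm, abs_mul, Real.mul_rpow (abs_nonneg _) (abs_nonneg _)]
  rw [← Finset.mul_sum, Real.mul_rpow (Real.rpow_nonneg (abs_nonneg _) _) (sum_abs_rpow_nonneg a),
    one_div, Real.rpow_rpow_inv (abs_nonneg _) hp0]

theorem finPNorm_add_le (hp : 1 ≤ p) (a b : Fin n → ℝ) :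
    finPNorm p (fun i => a i + b i) ≤ finPNorm p a + finPNorm p b :=
  Real.Lp_add_le _ _ _ hp

theorem norm_toLp_eq_finPNorm (hp : 1 ≤ p) (a : Fin n → ℝ) :
    ‖WithLp.toLp (ENNReal.ofReal p) a‖ = finPNorm p a := by
  have hpt : (ENNReal.ofReal p).toReal = p := ENNReal.toReal_ofReal (by linarith)
  rw [PiLp.norm_eq_sum (by rw [hpt]; linarith), hpt]
  rfl

end finPNorm

section weakPNorm

variable {X : Type u} [NormedAddCommGroup X] [NormedSpace ℝ X] {p : ℝ} {n : ℕ}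

/-- The weak `ℓ_p`-norm of a finite sequence of vectors. -/
noncomputable def weakPNorm (p : ℝ) (x : Fin n → X) : ℝ :=
  ⨆ φ : {φ : StrongDual ℝ X // ‖φ‖ ≤ 1}, finPNorm p fun i => φ.1 (x i)

theorem finPNorm_le_weakPNorm (hp : 1 ≤ p) (x : Fin n → X) {φ : StrongDual ℝ X} (hφ : ‖φ‖ ≤ 1) :
    finPNorm p (fun i => φ (x i)) ≤ weakPNorm p x := by
  refine le_ciSup (f := fun φ : {φ : StrongDual ℝ X // ‖φ‖ ≤ 1} =>
    finPNorm p fun i => φ.1 (x i)) ⟨finPNorm p fun i => ‖x i‖, ?_⟩ ⟨φ, hφ⟩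
  rintro _ ⟨ψ, rfl⟩
  refine finPNorm_mono hp fun i => ?_
  rw [abs_norm]
  exact (ψ.1.le_opNorm _).trans (mul_le_of_le_one_left (norm_nonneg _) ψ.2)

theorem weakPNorm_le {x : Fin n → X} {M : ℝ}
    (h : ∀ φ : StrongDual ℝ X, ‖φ‖ ≤ 1 → finPNorm p (fun i => φ (x i)) ≤ M) :
    weakPNorm p x ≤ M := by
  have : Nonempty {φ : StrongDual ℝ X // ‖φ‖ ≤ 1} := ⟨⟨0, by simp⟩⟩
  exact ciSup_le fun φ => h φ.1 φ.2

theorem weakPNorm_nonneg (x : Fin n → X) : 0 ≤ weakPNorm p x :=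
  Real.iSup_nonneg fun _ => finPNorm_nonneg _

theorem finPNorm_le_norm_mul_weakPNorm (hp : 1 ≤ p) (x : Fin n → X) (φ : StrongDual ℝ X) :
    finPNorm p (fun i => φ (x i)) ≤ ‖φ‖ * weakPNorm p x := by
  rcases eq_or_ne φ 0 with rfl | hφ
  · have := finPNorm_const_mul (n := n) hp 0 fun _ => 0
    simp only [zero_mul, abs_zero] at this
    simp [this]
  · have hpos : 0 < ‖φ‖ := norm_pos_iff.2 hφ
    have h := finPNorm_le_weakPNorm hp x (φ := ‖φ‖⁻¹ • φ)
      (by rw [norm_smul, norm_inv, norm_norm, inv_mul_cancel₀ hpos.ne'])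
    have h2 := finPNorm_const_mul hp ‖φ‖⁻¹ fun i => φ (x i)
    change finPNorm p (fun i => ‖φ‖⁻¹ * φ (x i)) ≤ _ at h
    rwa [h2, abs_of_pos (inv_pos.2 hpos), inv_mul_le_iff₀ hpos] at h

theorem weakPNorm_map_le (hp : 1 ≤ p) {Y : Type u} [NormedAddCommGroup Y] [NormedSpace ℝ Y]
    (S : X →L[ℝ] Y) (x : Fin n → X) : weakPNorm p (fun i => S (x i)) ≤ ‖S‖ * weakPNorm p x := by
  refine weakPNorm_le fun φ hφ => ?_
  refine (finPNorm_le_norm_mul_weakPNorm hp x (φ ∘L S)).trans ?_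
  refine mul_le_mul_of_nonneg_right ?_ (weakPNorm_nonneg x)
  exact (φ.opNorm_comp_le S).trans (mul_le_of_le_one_left (norm_nonneg _) hφ)

end weakPNorm

theorem mem_pSummingOps_iff {p : ℝ} {X Y : Type u} [NormedAddCommGroup X] [NormedSpace ℝ X]
    [CompleteSpace X] [NormedAddCommGroup Y] [NormedSpace ℝ Y] [CompleteSpace Y] {T : X →L[ℝ] Y} :
    T ∈ pSummingOps p X Y ↔ ∃ C : ℝ, 0 ≤ C ∧ ∀ (n : ℕ) (x : Fin n → X),
      finPNorm p (fun i => ‖T (x i)‖) ≤ C * weakPNorm p x := by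
  simp only [finPNorm, abs_norm]
  rfl

theorem isOperatorIdeal_pSummingOps {p : ℝ} (hp : 1 ≤ p) : IsOperatorIdeal (pSummingOps.{u} p) := by
  have hcomp : ∀ (W X Y Z : Type u) [NormedAddCommGroup W] [NormedSpace ℝ W] [CompleteSpace W]
      [NormedAddCommGroup X] [NormedSpace ℝ X] [CompleteSpace X]
      [NormedAddCommGroup Y] [NormedSpace ℝ Y] [CompleteSpace Y]
      [NormedAddCommGroup Z] [NormedSpace ℝ Z] [CompleteSpace Z]
      (S : W →L[ℝ] X) (T : X →L[ℝ] Y) (R : Y →L[ℝ] Z),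
      T ∈ pSummingOps p X Y → R ∘L T ∘L S ∈ pSummingOps p W Z := by
    intro W X Y Z _ _ _ _ _ _ _ _ _ _ _ _ S T R hT
    obtain ⟨C, hC, h⟩ := mem_pSummingOps_iff.1 hT
    refine mem_pSummingOps_iff.2 ⟨‖R‖ * (C * ‖S‖), by positivity, fun n w => ?_⟩
    calc finPNorm p (fun i => ‖R (T (S (w i)))‖)
        ≤ finPNorm p (fun i => ‖R‖ * ‖T (S (w i))‖) := finPNorm_mono hp fun i => by
          rw [abs_norm, abs_of_nonneg (by positivity)]
          exact R.le_opNorm _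
      _ = ‖R‖ * finPNorm p (fun i => ‖T (S (w i))‖) := by
          rw [finPNorm_const_mul hp, abs_norm]
      _ ≤ ‖R‖ * (C * (‖S‖ * weakPNorm p w)) := by
          gcongr
          exact (h n _).trans (mul_le_mul_of_nonneg_left (weakPNorm_map_le hp S w) hC)
      _ = _ := by ring
  refine ⟨?_, ?_, ?_, ?_, hcomp⟩
  · intro X Y _ _ _ _ _ _
    refine mem_pSummingOps_iff.2 ⟨0, le_rfl, fun n x => ?_⟩
    have := finPNorm_const_mul (n := n) hp 0 fun _ => 0
    simp only [zero_mul, abs_zero] at this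
    simp [this]
  · intro X Y _ _ _ _ _ _ S T hS hT
    obtain ⟨C, hC, h⟩ := mem_pSummingOps_iff.1 hS
    obtain ⟨D, hD, h'⟩ := mem_pSummingOps_iff.1 hT
    refine mem_pSummingOps_iff.2 ⟨C + D, by positivity, fun n x => ?_⟩
    calc finPNorm p (fun i => ‖S (x i) + T (x i)‖)
        ≤ finPNorm p (fun i => ‖S (x i)‖ + ‖T (x i)‖) := finPNorm_mono hp fun i => by
          rw [abs_norm, abs_of_nonneg (by positivity)]
          exact norm_add_le _ _
      _ ≤ _ := (finPNorm_add_le hp _ _).trans (add_le_add (h n x) (h' n x))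
      _ = _ := by ring
  · intro X Y _ _ _ _ _ _ c T hT
    exact hcomp X X Y Y (ContinuousLinearMap.id ℝ X) T (c • ContinuousLinearMap.id ℝ Y) hT
  · intro X Y _ _ _ _ _ _ φ y
    refine mem_pSummingOps_iff.2 ⟨‖y‖ * ‖φ‖, by positivity, fun n x => ?_⟩
    have h : ∀ i, |‖φ.smulRight y (x i)‖| ≤ |‖y‖ * φ (x i)| := fun i => by
      rw [abs_norm, ContinuousLinearMap.smulRight_apply, norm_smul, abs_mul, abs_norm, mul_comm,
        Real.norm_eq_abs]
    refine (finPNorm_mono hp h).trans ?_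
    rw [finPNorm_const_mul hp, abs_norm, mul_assoc]
    exact mul_le_mul_of_nonneg_left (finPNorm_le_norm_mul_weakPNorm hp x φ) (norm_nonneg _)

/-! ### The second adjoint of a `p`-summing operator is `p`-summing -/

section Extension

/-- In a finite-dimensional space, finitely many functionals of norm at most one determine the
norm up to a factor `2`. -/
theorem exists_finset_dual_norm_le (E : Type*) [NormedAddCommGroup E] [NormedSpace ℝ E]
    [FiniteDimensional ℝ E] : ∃ t : Finset (StrongDual ℝ E), (∀ b ∈ t, ‖b‖ ≤ 1) ∧
      ∀ a : E, ‖a‖ ≤ 2 * ‖fun b : t => b.1 a‖ := by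
  have : ProperSpace (StrongDual ℝ E) := FiniteDimensional.proper ℝ _
  obtain ⟨t, ht, htf, hcov⟩ :=
    (isCompact_closedBall (0 : StrongDual ℝ E) 1).finite_cover_balls (e := 1 / 2) (by norm_num)
  refine ⟨htf.toFinset, fun b hb => ?_, fun a => ?_⟩
  · simpa using ht (htf.mem_toFinset.1 hb)
  · obtain ⟨f, hf, hfa⟩ := exists_dual_vector'' ℝ a
    obtain ⟨b, hb, hfb⟩ := Set.mem_iUnion₂.1 (hcov (mem_closedBall_zero_iff.2 hf))
    have h1 : ‖b a‖ ≤ ‖fun b : htf.toFinset => b.1 a‖ :=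
      norm_le_pi_norm (fun b : htf.toFinset => b.1 a) ⟨b, htf.mem_toFinset.2 hb⟩
    have h2 : ‖(f - b) a‖ ≤ 1 / 2 * ‖a‖ := by
      refine ((f - b).le_opNorm a).trans (mul_le_mul_of_nonneg_right ?_ (norm_nonneg _))
      rw [← dist_eq_norm]
      exact (Metric.mem_ball.1 hfb).le
    have h3 : ‖f a‖ ≤ ‖(f - b) a‖ + ‖b a‖ := by
      simpa using norm_add_le ((f - b) a) (b a)
    have h4 : f a = ‖a‖ := hfa
    rw [h4, norm_norm] at h3
    linarith

/-- The bound forces `ψ` to vanish on the kernel of `Λ`, so `ψ` descends to the range of `Λ`;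
Hahn–Banach extends it from there. -/
theorem exists_dual_comp_eq {V W : Type*} [AddCommGroup V] [Module ℝ V] [NormedAddCommGroup W]
    [NormedSpace ℝ W] (Λ : V →ₗ[ℝ] W) (ψ : V →ₗ[ℝ] ℝ) {K : ℝ} (hK : 0 ≤ K)
    (h : ∀ v, |ψ v| ≤ K * ‖Λ v‖) : ∃ g : StrongDual ℝ W, ‖g‖ ≤ K ∧ ∀ v, g (Λ v) = ψ v := by
  obtain ⟨s, hs⟩ := Λ.rangeRestrict.exists_rightInverse_of_surjective Λ.range_rangeRestrict
  have hs' : ∀ w, Λ (s w) = w := fun w => congrArg Subtype.val (LinearMap.congr_fun hs w)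
  let g₀ : StrongDual ℝ Λ.range := (ψ ∘ₗ s).mkContinuous K fun w => by
    have := h (s w)
    rwa [hs'] at this
  obtain ⟨g, hg, hgn⟩ := exists_extension_norm_eq Λ.range g₀
  refine ⟨g, hgn ▸ LinearMap.mkContinuous_norm_le _ hK _, fun v => ?_⟩
  have h1 : g (Λ v) = ψ (s ⟨Λ v, v, rfl⟩) := hg ⟨Λ v, v, rfl⟩
  have h2 := h (v - s ⟨Λ v, v, rfl⟩)
  rw [map_sub, map_sub, hs', sub_self, norm_zero, mul_zero] at h2
  rw [h1]
  exact (eq_of_abs_sub_nonpos h2).symm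

/-- The dual of an `ℓ_∞`-sum carries the `ℓ_1`-norm: almost norming vectors for the components
assemble into one vector of sup norm at most `1`. -/
theorem sum_norm_comp_single_le {ι X : Type*} [Fintype ι] [DecidableEq ι] [NormedAddCommGroup X]
    [NormedSpace ℝ X] (g : StrongDual ℝ (ι → X)) :
    ∑ k, ‖g ∘L ContinuousLinearMap.single ℝ (fun _ : ι => X) k‖ ≤ ‖g‖ := by
  refine le_of_forall_pos_le_add fun ε hε => ?_
  have hδ : 0 < ε / (Fintype.card ι + 1) := by positivity
  have hx : ∀ k, ∃ x : X, ‖x‖ ≤ 1 ∧ ‖g ∘L ContinuousLinearMap.single ℝ (fun _ : ι => X) k‖ ≤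
      g (Pi.single k x) + ε / (Fintype.card ι + 1) := by
    intro k
    set gk := g ∘L ContinuousLinearMap.single ℝ (fun _ : ι => X) k with hgk
    obtain ⟨ξ, hξ, hξg⟩ := exists_dual_vector'' ℝ gk
    obtain ⟨x, hx, hxg⟩ := exists_norm_le_one_forall_abs_sub_lt hξ {gk} hδ
    refine ⟨x, hx, ?_⟩
    have h1 := (abs_lt.1 (hxg gk (by simp))).1
    have h2 : gk x = g (Pi.single k x) := rfl
    have h3 : ξ gk = ‖gk‖ := hξg
    rw [h2, h3] at h1
    linarith
  choose x hx1 hx2 using hx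
  have hsum : ∑ k, g (Pi.single k (x k)) = g x := by
    rw [← map_sum, Finset.univ_sum_single]
  have hxn : ‖x‖ ≤ 1 := (pi_norm_le_iff_of_nonneg zero_le_one).2 hx1
  calc _ ≤ ∑ k, (g (Pi.single k (x k)) + ε / (Fintype.card ι + 1)) :=
        Finset.sum_le_sum fun k _ => hx2 k
    _ = g x + Fintype.card ι * (ε / (Fintype.card ι + 1)) := by
        rw [Finset.sum_add_distrib, hsum]
        simp
    _ ≤ ‖g‖ + ε := by
        refine add_le_add ((Real.le_norm_self _).trans ((g.le_opNorm x).trans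
          (mul_le_of_le_one_right (norm_nonneg _) hxn))) ?_
        rw [← mul_div_assoc, div_le_iff₀ (by positivity)]
        nlinarith

end Extension

/-- The `p`-summing inequality is dualised to an identity between finitely many functionals in `X*`,
on which elements of `X**` can be evaluated. The factor `2` is lost in replacing the dual ball of
`ℓ_p^n` by a finite set. -/
theorem finPNorm_bidual_le {p : ℝ} (hp : 1 ≤ p) {X Y : Type u} [NormedAddCommGroup X]
    [NormedSpace ℝ X] [NormedAddCommGroup Y] [NormedSpace ℝ Y] {T : X →L[ℝ] Y} {C : ℝ}
    (hC : 0 ≤ C) (hT : ∀ (n : ℕ) (x : Fin n → X),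
      finPNorm p (fun i => ‖T (x i)‖) ≤ C * weakPNorm p x)
    {S : StrongDual ℝ (StrongDual ℝ X) →L[ℝ] Y}
    (hS : NormedSpace.inclusionInDoubleDual ℝ Y ∘L S = conjOp (conjOp T))
    (n : ℕ) (ξ : Fin n → StrongDual ℝ (StrongDual ℝ X)) :
    finPNorm p (fun i => ‖S (ξ i)‖) ≤ C * 2 * weakPNorm p ξ := by
  classical
  have : Fact (1 ≤ ENNReal.ofReal p) := ⟨by simpa using hp⟩
  let E := PiLp (ENNReal.ofReal p) fun _ : Fin n => ℝ
  let toE : (Fin n → ℝ) → E := WithLp.toLp (ENNReal.ofReal p)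
  let e : Fin n → E := fun i => toE (Pi.single i 1)
  have hrep : ∀ (b : StrongDual ℝ E) (a : Fin n → ℝ), b (toE a) = ∑ i, b (e i) * a i := by
    intro b a
    have : toE a = ∑ i, a i • e i := by
      ext j
      rw [WithLp.ofLp_sum, Finset.sum_apply]
      change a j = ∑ i, a i * (Pi.single i (1 : ℝ) : Fin n → ℝ) j
      simp [Pi.single_apply]
    rw [this, map_sum]
    exact Finset.sum_congr rfl fun i _ => by rw [map_smul, smul_eq_mul, mul_comm]
  have hbound : ∀ (b : StrongDual ℝ E) (a : Fin n → ℝ), ‖b‖ ≤ 1 →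
      |∑ i, b (e i) * a i| ≤ finPNorm p a := by
    intro b a hb
    rw [← hrep, ← norm_toLp_eq_finPNorm hp]
    exact (b.le_opNorm _).trans (mul_le_of_le_one_left (norm_nonneg _) hb)
  obtain ⟨t, ht, htE⟩ := exists_finset_dual_norm_le E
  obtain ⟨c, hc, hcS⟩ := exists_dual_vector'' ℝ (toE fun i => ‖S (ξ i)‖)
  have hy : ∀ i, ∃ y : StrongDual ℝ Y, ‖y‖ ≤ 1 ∧ y (S (ξ i)) = ‖S (ξ i)‖ := fun i =>
    exists_dual_vector'' ℝ (S (ξ i))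
  choose y hy1 hy2 using hy
  -- The sup norm of `Λ x` controls the weak `ℓ_p`-norm of `x` up to the factor `2`, while `ψ` tests
  -- the strong `ℓ_p`-norm of `(T xᵢ)` against functionals norming `(S ξᵢ)`.
  let Λ : (Fin n → X) →ₗ[ℝ] (t → X) :=
    LinearMap.pi fun b => ∑ i, b.1 (e i) • LinearMap.proj i
  let ψ : (Fin n → X) →ₗ[ℝ] ℝ :=
    ∑ i, c (e i) • ((y i ∘L T).toLinearMap ∘ₗ LinearMap.proj i)
  have hΛ : ∀ (x : Fin n → X) (b : t), Λ x b = ∑ i, b.1 (e i) • x i := fun x b => by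
    simp [Λ]
  have hψ : ∀ x : Fin n → X, ψ x = ∑ i, c (e i) * y i (T (x i)) := fun x => by
    simp [ψ]
  have hψle : ∀ x, |ψ x| ≤ C * 2 * ‖Λ x‖ := by
    intro x
    rw [hψ]
    refine (hbound c _ hc).trans ?_
    refine (finPNorm_mono hp (b := fun i => ‖T (x i)‖) fun i => ?_).trans ?_
    · rw [abs_norm]
      exact ((y i).le_opNorm _).trans (mul_le_of_le_one_left (norm_nonneg _) (hy1 i))
    · refine (hT n x).trans ?_
      rw [mul_assoc]
      refine mul_le_mul_of_nonneg_left (weakPNorm_le fun φ hφ => ?_) hC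
      rw [← norm_toLp_eq_finPNorm hp]
      refine (htE _).trans (mul_le_mul_of_nonneg_left ?_ zero_le_two)
      refine (pi_norm_le_iff_of_nonneg (norm_nonneg _)).2 fun b => ?_
      have h1 : b.1 (toE fun i => φ (x i)) = φ (Λ x b) := by
        rw [hrep, hΛ, map_sum]
        exact Finset.sum_congr rfl fun i _ => by rw [map_smul, smul_eq_mul]
      change ‖b.1 (toE fun i => φ (x i))‖ ≤ _
      rw [h1]
      exact (φ.le_opNorm _).trans ((mul_le_of_le_one_left (norm_nonneg _) hφ).trans
        (norm_le_pi_norm _ b))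
  obtain ⟨g, hg, hgψ⟩ := exists_dual_comp_eq Λ ψ (by positivity) hψle
  let gk : t → StrongDual ℝ X := fun k => g ∘L ContinuousLinearMap.single ℝ (fun _ : t => X) k
  -- Coordinatewise form of `ψ = g ∘ Λ`. Pairing it with `ξ i` moves the estimate from `X` to `X**`.
  have hfun : ∀ i, c (e i) • (y i ∘L T) = ∑ k : t, k.1 (e i) • gk k := by
    intro i
    ext x
    have h1 : ψ (Pi.single i x) = c (e i) * y i (T x) := by
      rw [hψ, Finset.sum_eq_single i]
      · simp
      · intro j _ hj
        simp [hj]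
      · simp
    have h2 : Λ (Pi.single i x) = fun k : t => k.1 (e i) • x := by
      ext k
      rw [hΛ, Finset.sum_eq_single i]
      · simp
      · intro j _ hj
        simp [hj]
      · simp
    have h3 : g (fun k : t => k.1 (e i) • x) = ∑ k : t, k.1 (e i) * g (Pi.single k x) := by
      conv_lhs => rw [← Finset.univ_sum_single fun k : t => k.1 (e i) • x]
      rw [map_sum]
      refine Finset.sum_congr rfl fun k _ => ?_
      rw [Pi.single_smul, map_smul, smul_eq_mul]
    have h4 := hgψ (Pi.single i x)
    rw [h1, h2, h3] at h4
    simp only [_root_.sum_apply]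
    exact h4.symm
  have hη : ∀ k : t, ‖∑ i, k.1 (e i) • ξ i‖ ≤ weakPNorm p ξ := by
    intro k
    obtain ⟨φ, hφ, hφk⟩ := exists_dual_vector'' ℝ (∑ i, k.1 (e i) • ξ i)
    have h1 : φ (∑ i, k.1 (e i) • ξ i) = ∑ i, k.1 (e i) * φ (ξ i) := by
      rw [map_sum]
      exact Finset.sum_congr rfl fun i _ => by rw [map_smul, smul_eq_mul]
    have h2 : ‖∑ i, k.1 (e i) • ξ i‖ = φ (∑ i, k.1 (e i) • ξ i) := hφk.symm
    rw [h2, h1]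
    exact (le_abs_self _).trans ((hbound _ _ (ht _ k.2)).trans (finPNorm_le_weakPNorm hp ξ hφ))
  have hSξ : ∀ i, y i (S (ξ i)) = ξ i (y i ∘L T) := fun i =>
    DFunLike.congr_fun (DFunLike.congr_fun hS (ξ i)) (y i)
  calc finPNorm p (fun i => ‖S (ξ i)‖) = c (toE fun i => ‖S (ξ i)‖) := by
        rw [← norm_toLp_eq_finPNorm hp]
        exact hcS.symm
    _ = ∑ i, ξ i (c (e i) • (y i ∘L T)) := by
        rw [hrep]
        refine Finset.sum_congr rfl fun i _ => ?_
        rw [map_smul, ← hSξ, hy2, smul_eq_mul]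
    _ = ∑ k : t, (∑ i, k.1 (e i) • ξ i) (gk k) := by
        simp only [hfun, map_sum, map_smul, _root_.sum_apply]
        exact Finset.sum_comm
    _ ≤ ∑ k : t, weakPNorm p ξ * ‖gk k‖ := by
        refine Finset.sum_le_sum fun k _ => ?_
        exact (Real.le_norm_self _).trans ((ContinuousLinearMap.le_opNorm _ _).trans
          (mul_le_mul_of_nonneg_right (hη k) (norm_nonneg _)))
    _ = weakPNorm p ξ * ∑ k : t, ‖gk k‖ := by rw [Finset.mul_sum]
    _ ≤ weakPNorm p ξ * (C * 2) :=
        mul_le_mul_of_nonneg_left ((sum_norm_comp_single_le g).trans hg) (weakPNorm_nonneg _)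
    _ = _ := mul_comm _ _

/-! ### `p`-summing operators are weakly compact -/

section Domination

/-- Parallelogram identity for the squares, then superadditivity and convexity of `t ↦ t ^ p`. The
exponent `2p ≥ 2` makes this work down to `p = 1`. -/
theorem abs_half_add_rpow_add_abs_half_sub_rpow_le {p : ℝ} (hp : 1 ≤ p) (a b : ℝ) :
    |1 / 2 * (a + b)| ^ (2 * p) + |1 / 2 * (a - b)| ^ (2 * p) ≤
      (|a| ^ (2 * p) + |b| ^ (2 * p)) / 2 := by
  have hsq : ∀ c : ℝ, |c| ^ (2 * p) = (c ^ 2) ^ p := fun c => by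
    rw [Real.rpow_mul (abs_nonneg _), Real.rpow_two, sq_abs]
  simp only [hsq]
  set u := (1 / 2 * (a + b)) ^ 2
  set v := (1 / 2 * (a - b)) ^ 2
  have huv : u + v = 1 / 2 * a ^ 2 + 1 / 2 * b ^ 2 := by simp only [u, v]; ring
  have h1 : u ^ p + v ^ p ≤ (u + v) ^ p := Real.add_rpow_le_rpow_add (sq_nonneg _) (sq_nonneg _) hp
  have h2 := (convexOn_rpow hp).2 (Set.mem_Ici.2 (sq_nonneg a)) (Set.mem_Ici.2 (sq_nonneg b))
    (by norm_num : (0 : ℝ) ≤ 1 / 2) (by norm_num : (0 : ℝ) ≤ 1 / 2) (by norm_num)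
  simp only [smul_eq_mul] at h2
  rw [huv] at h1
  linarith

variable {X Y : Type u} [NormedAddCommGroup X] [NormedSpace ℝ X]
  [NormedAddCommGroup Y] [NormedSpace ℝ Y]

/-- Pairs of functions on `X` having the convex properties common to all pairs
`(|φ| ^ p, |φ| ^ (2 * p))` with `φ` in the dual unit ball. -/
def dominatingPairs (p : ℝ) (X : Type u) [NormedAddCommGroup X] [NormedSpace ℝ X] :
    Set ((X → ℝ) × (X → ℝ)) :=
  {Q | (∀ x, 0 ≤ Q.1 x ∧ Q.1 x ^ 2 ≤ Q.2 x ∧ Q.2 x ≤ ‖x‖ ^ (2 * p)) ∧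
    ∀ x y, Q.2 ((1 / 2 : ℝ) • (x + y)) + Q.2 ((1 / 2 : ℝ) • (x - y)) ≤ (Q.2 x + Q.2 y) / 2}

theorem mem_dominatingPairs {p : ℝ} (hp : 1 ≤ p) {φ : StrongDual ℝ X} (hφ : ‖φ‖ ≤ 1) :
    ((fun x => |φ x| ^ p, fun x => |φ x| ^ (2 * p)) : (X → ℝ) × (X → ℝ)) ∈
      dominatingPairs p X := by
  refine ⟨fun x => ⟨Real.rpow_nonneg (abs_nonneg _) _, ?_, ?_⟩, fun x y => ?_⟩
  · change (|φ x| ^ p) ^ 2 ≤ |φ x| ^ (2 * p)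
    rw [mul_comm, Real.rpow_mul (abs_nonneg _), Real.rpow_two]
  · exact Real.rpow_le_rpow (abs_nonneg _)
      ((φ.le_opNorm x).trans (mul_le_of_le_one_left (norm_nonneg _) hφ)) (by linarith)
  · have := abs_half_add_rpow_add_abs_half_sub_rpow_le hp (φ x) (φ y)
    simpa only [map_smul, map_add, map_sub, smul_eq_mul] using this

theorem convex_dominatingPairs (p : ℝ) : Convex ℝ (dominatingPairs p X) := by
  rintro Q ⟨hQ, hQ'⟩ R ⟨hR, hR'⟩ a b ha hb hab
  refine ⟨fun x => ⟨?_, ?_, ?_⟩, fun x y => ?_⟩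
  · exact add_nonneg (mul_nonneg ha (hQ x).1) (mul_nonneg hb (hR x).1)
  · have h := (even_two.convexOn_pow (𝕜 := ℝ)).2 (Set.mem_univ (Q.1 x)) (Set.mem_univ (R.1 x))
      ha hb hab
    refine h.trans ?_
    exact add_le_add (mul_le_mul_of_nonneg_left (hQ x).2.1 ha)
      (mul_le_mul_of_nonneg_left (hR x).2.1 hb)
  · calc a * Q.2 x + b * R.2 x ≤ a * ‖x‖ ^ (2 * p) + b * ‖x‖ ^ (2 * p) :=
          add_le_add (mul_le_mul_of_nonneg_left (hQ x).2.2 ha)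
            (mul_le_mul_of_nonneg_left (hR x).2.2 hb)
      _ = ‖x‖ ^ (2 * p) := by rw [← add_mul, hab, one_mul]
  · have h1 := mul_le_mul_of_nonneg_left (hQ' x y) ha
    have h2 := mul_le_mul_of_nonneg_left (hR' x y) hb
    simp only [Prod.snd_add, Prod.smul_snd, Pi.add_apply, Pi.smul_apply, smul_eq_mul]
    linarith

theorem isCompact_dominatingPairs (p : ℝ) : IsCompact (dominatingPairs p X) := by
  have hK : IsCompact ((Set.univ.pi fun x : X => Set.Icc (0 : ℝ) (‖x‖ ^ p)) ×ˢ
      (Set.univ.pi fun x : X => Set.Icc (0 : ℝ) (‖x‖ ^ (2 * p)))) :=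
    (isCompact_univ_pi fun _ => isCompact_Icc).prod (isCompact_univ_pi fun _ => isCompact_Icc)
  have h1 : ∀ x : X, Continuous fun Q : (X → ℝ) × (X → ℝ) => Q.1 x := fun x =>
    (continuous_apply x).comp continuous_fst
  have h2 : ∀ x : X, Continuous fun Q : (X → ℝ) × (X → ℝ) => Q.2 x := fun x =>
    (continuous_apply x).comp continuous_snd
  refine hK.of_isClosed_subset ?_ ?_
  · refine IsClosed.inter (s₁ := {Q : (X → ℝ) × (X → ℝ) | ∀ x, 0 ≤ Q.1 x ∧ Q.1 x ^ 2 ≤ Q.2 x ∧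
      Q.2 x ≤ ‖x‖ ^ (2 * p)})
      (s₂ := {Q | ∀ x y, Q.2 ((1 / 2 : ℝ) • (x + y)) + Q.2 ((1 / 2 : ℝ) • (x - y)) ≤
        (Q.2 x + Q.2 y) / 2}) ?_ ?_
    · simp only [Set.ofPred_forall, Set.ofPred_and]
      exact isClosed_iInter fun x => (isClosed_le continuous_const (h1 x)).inter
        ((isClosed_le ((h1 x).pow 2) (h2 x)).inter (isClosed_le (h2 x) continuous_const))
    · simp only [Set.ofPred_forall]
      exact isClosed_iInter fun x => isClosed_iInter fun y =>
        isClosed_le ((h2 _).add (h2 _)) (((h2 _).add (h2 _)).div_const 2)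
  · rintro Q ⟨hQ, -⟩
    refine ⟨fun x _ => ⟨(hQ x).1, ?_⟩, fun x _ => ⟨(sq_nonneg _).trans (hQ x).2.1, (hQ x).2.2⟩⟩
    have h := (hQ x).2.1.trans (hQ x).2.2
    rw [mul_comm, Real.rpow_mul (norm_nonneg _), Real.rpow_two] at h
    exact (sq_le_sq₀ (hQ x).1 (Real.rpow_nonneg (norm_nonneg _) _)).1 h

theorem sum_norm_rpow_le_of_pSumming {p : ℝ} (hp : 1 ≤ p) {T : X →L[ℝ] Y} {C : ℝ} (hC : 0 ≤ C)
    (hT : ∀ (n : ℕ) (x : Fin n → X), finPNorm p (fun i => ‖T (x i)‖) ≤ C * weakPNorm p x)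
    {ι : Type*} [Fintype ι] (x : ι → X) {M : ℝ} (hM : 0 ≤ M)
    (h : ∀ φ : StrongDual ℝ X, ‖φ‖ ≤ 1 → ∑ i, |φ (x i)| ^ p ≤ M) :
    ∑ i, ‖T (x i)‖ ^ p ≤ C ^ p * M := by
  have hp0 : 0 < p := by linarith
  let e := (Fintype.equivFin ι).symm
  have h1 : weakPNorm p (fun i => x (e i)) ≤ M ^ (1 / p) := weakPNorm_le fun φ hφ => by
    refine Real.rpow_le_rpow (sum_abs_rpow_nonneg _) ?_ (one_div_nonneg.2 hp0.le)
    rw [e.sum_comp fun i => |φ (x i)| ^ p]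
    exact h φ hφ
  have h2 := (hT _ fun i => x (e i)).trans (mul_le_mul_of_nonneg_left h1 hC)
  have h3 := Real.rpow_le_rpow (finPNorm_nonneg _) h2 hp0.le
  rw [finPNorm, one_div, Real.rpow_inv_rpow (sum_abs_rpow_nonneg _) hp0.ne',
    Real.mul_rpow hC (Real.rpow_nonneg hM _), Real.rpow_inv_rpow hM hp0.ne'] at h3
  simp only [abs_norm] at h3
  rwa [e.sum_comp fun i => ‖T (x i)‖ ^ p] at h3

/-- A form of Pietsch's domination theorem. -/
theorem exists_dominatingPair {p : ℝ} (hp : 1 ≤ p) {T : X →L[ℝ] Y} {C : ℝ} (hC : 0 < C)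
    (hT : ∀ (n : ℕ) (x : Fin n → X), finPNorm p (fun i => ‖T (x i)‖) ≤ C * weakPNorm p x) :
    ∃ Q ∈ dominatingPairs p X, ∀ x, ‖T x‖ ^ p ≤ C ^ p * Q.1 x := by
  have hp0 : 0 < p := by linarith
  have hCp : 0 < C ^ p := Real.rpow_pos_of_pos hC p
  have h1 : ∀ x : X, Continuous fun Q : (X → ℝ) × (X → ℝ) => C ^ p * Q.1 x := fun x =>
    continuous_const.mul ((continuous_apply x).comp continuous_fst)
  -- Compactness reduces to finitely many `x`; a failure there separates a compact convex set from a
  -- translated orthant. The convex set of pairs plays the role of the probability measures on the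
  -- dual ball.
  obtain ⟨Q, hQ, hQ'⟩ := (isCompact_dominatingPairs p).inter_iInter_nonempty
    (fun x : X => {Q : (X → ℝ) × (X → ℝ) | ‖T x‖ ^ p ≤ C ^ p * Q.1 x})
    (fun x => isClosed_le continuous_const (h1 x)) (by
      classical
      intro s
      by_contra hcon
      let L : ((X → ℝ) × (X → ℝ)) →ₗ[ℝ] (s → ℝ) :=
        LinearMap.pi fun i => C ^ p • (LinearMap.proj i.1 ∘ₗ LinearMap.fst ℝ (X → ℝ) (X → ℝ))
      have hL : Continuous L := continuous_pi fun i => h1 i.1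
      obtain ⟨f, u, v, hfu, huv, hvf⟩ := geometric_hahn_banach_compact_closed
        ((convex_dominatingPairs p).linear_image L) ((isCompact_dominatingPairs p).image hL)
        (convex_Ici (𝕜 := ℝ) fun i : s => ‖T i.1‖ ^ p) isClosed_Ici (by
          rw [Set.disjoint_left]
          rintro _ ⟨Q, hQ, rfl⟩ hQ'
          refine hcon ⟨Q, hQ, ?_⟩
          simp only [Set.mem_iInter]
          exact fun i hi => hQ' ⟨i, hi⟩)
      set w : s → ℝ := fun i => f (Pi.single i 1) with hw
      have hrep : ∀ b : s → ℝ, f b = ∑ i, w i * b i := fun b => by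
        conv_lhs => rw [pi_eq_sum_univ' b]
        rw [map_sum]
        exact Finset.sum_congr rfl fun i _ => by rw [map_smul, smul_eq_mul, mul_comm]
      -- The orthant is unbounded upwards, so a functional bounded below on it has nonnegative
      -- weights.
      have hw0 : ∀ i, 0 ≤ w i := by
        intro i
        by_contra hneg
        push Not at hneg
        set b : s → ℝ := fun i => ‖T i.1‖ ^ p
        obtain ⟨n, hn⟩ := exists_nat_gt ((f b - v) / -w i)
        have h := hvf (b + (n : ℝ) • Pi.single i 1)
          (Set.mem_Ici.2 (le_add_of_nonneg_right (smul_nonneg n.cast_nonneg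
            (Pi.single_nonneg.2 zero_le_one))))
        rw [map_add, map_smul, smul_eq_mul] at h
        rw [div_lt_iff₀ (by linarith)] at hn
        have : f (Pi.single i 1) = w i := rfl
        rw [this] at h
        linarith
      have hu : ∀ φ : StrongDual ℝ X, ‖φ‖ ≤ 1 →
          ∑ i, |φ (w i ^ (1 / p) • i.1)| ^ p ≤ (C ^ p)⁻¹ * u := by
        intro φ hφ
        have h := hfu _ ⟨_, mem_dominatingPairs hp hφ, rfl⟩
        rw [← ContinuousLinearMap.coe_coe, ContinuousLinearMap.coe_coe, hrep] at h
        rw [le_inv_mul_iff₀ hCp, Finset.mul_sum]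
        refine le_of_eq_of_le (Finset.sum_congr rfl fun i _ => ?_) h.le
        rw [map_smul, smul_eq_mul, abs_mul, Real.mul_rpow (abs_nonneg _) (abs_nonneg _),
          abs_of_nonneg (Real.rpow_nonneg (hw0 i) _), one_div, Real.rpow_inv_rpow (hw0 i) hp0.ne']
        change _ = w i * (C ^ p * |φ i.1| ^ p)
        ring
      have hu0 : 0 ≤ (C ^ p)⁻¹ * u :=
        (Finset.sum_nonneg fun i _ => Real.rpow_nonneg (abs_nonneg _) _).trans (hu 0 (by simp))
      -- Rescaling the vectors by `w i ^ (1 / p)` turns the weighted sums into unweighted ones; the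
      -- `p`-summing bound then contradicts `u < v`.
      have h2 := sum_norm_rpow_le_of_pSumming hp hC.le hT (fun i : s => w i ^ (1 / p) • i.1) hu0 hu
      rw [mul_inv_cancel_left₀ hCp.ne'] at h2
      have h3 := hvf (fun i : s => ‖T i.1‖ ^ p) (Set.mem_Ici.2 le_rfl)
      rw [hrep] at h3
      have h4 : ∑ i : s, ‖T (w i ^ (1 / p) • i.1)‖ ^ p = ∑ i : s, w i * ‖T i.1‖ ^ p := by
        refine Finset.sum_congr rfl fun i _ => ?_
        rw [map_smul, norm_smul, Real.mul_rpow (norm_nonneg _) (norm_nonneg _), Real.norm_eq_abs,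
          abs_of_nonneg (Real.rpow_nonneg (hw0 i) _), one_div, Real.rpow_inv_rpow (hw0 i) hp0.ne']
      rw [h4] at h2
      linarith)
  exact ⟨Q, hQ, fun x => Set.mem_iInter.1 hQ' x⟩

/-- If `T` is controlled by a uniformly convex function, then `T**` takes its values in the
canonical copy of the target space. -/
theorem mem_closure_range_of_uniformlyConvex {T : X →L[ℝ] Y} {Q : X → ℝ} (hQ0 : ∀ x, 0 ≤ Q x)
    (hQ1 : ∀ x, ‖x‖ ≤ 1 → Q x ≤ 1)
    (hQ : ∀ x y, Q ((1 / 2 : ℝ) • (x + y)) + Q ((1 / 2 : ℝ) • (x - y)) ≤ (Q x + Q y) / 2)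
    (hT : ∀ ε : ℝ, 0 < ε → ∃ δ : ℝ, 0 < δ ∧ ∀ x, Q x < δ → ‖T x‖ < ε)
    {ξ : StrongDual ℝ (StrongDual ℝ X)} (hξ : ‖ξ‖ ≤ 1) :
    conjOp (conjOp T) ξ ∈ closure (Set.range (NormedSpace.inclusionInDoubleDual ℝ Y)) := by
  classical
  let V : Finset (StrongDual ℝ X) × {ε : ℝ // 0 < ε} → Set X := fun i =>
    {x | ‖x‖ ≤ 1 ∧ ∀ f ∈ i.1, |f x - ξ f| < i.2}
  have hV : ∀ i, (V i).Nonempty := fun i => exists_norm_le_one_forall_abs_sub_lt hξ i.1 i.2.2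
  -- The supremum of these infima over weak* neighbourhoods of `ξ` is the asymptotic minimum of `Q`
  -- near `ξ`; almost minimisers will be forced together by uniform convexity.
  let d : Finset (StrongDual ℝ X) × {ε : ℝ // 0 < ε} → ℝ := fun i => sInf (Q '' V i)
  have hbdd : ∀ i, BddBelow (Q '' V i) := fun i => ⟨0, by rintro _ ⟨x, -, rfl⟩; exact hQ0 x⟩
  have hdle : ∀ i x, x ∈ V i → d i ≤ Q x := fun i x hx => csInf_le (hbdd i) ⟨x, hx, rfl⟩
  have hd1 : ∀ i, d i ≤ 1 := fun i =>
    let ⟨x, hx⟩ := hV i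
    (hdle i x hx).trans (hQ1 x hx.1)
  have hdb : BddAbove (Set.range d) := ⟨1, by rintro _ ⟨i, rfl⟩; exact hd1 i⟩
  have : Nonempty (Finset (StrongDual ℝ X) × {ε : ℝ // 0 < ε}) := ⟨(∅, ⟨1, one_pos⟩)⟩
  have hnear : ∀ i, ∀ η : ℝ, 0 < η → ∃ x ∈ V i, Q x < (⨆ i, d i) + η := by
    intro i η hη
    obtain ⟨_, ⟨x, hx, rfl⟩, hlt⟩ := exists_lt_of_csInf_lt ((hV i).image Q)
      (lt_add_of_pos_right (d i) hη)
    exact ⟨x, hx, hlt.trans_le (add_le_add_left (le_ciSup hdb i) η)⟩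
  rw [Metric.mem_closure_iff]
  intro ε hε
  obtain ⟨δ, hδ, hδT⟩ := hT (ε / 4) (by positivity)
  obtain ⟨i₀, hi₀⟩ := exists_lt_of_lt_ciSup (sub_lt_self (⨆ i, d i) (half_pos hδ))
  obtain ⟨x₀, hx₀, hQx₀⟩ := hnear i₀ (δ / 2) (half_pos hδ)
  have hclose : ∀ y ∈ V i₀, Q y < (⨆ i, d i) + δ / 2 → ‖T (x₀ - y)‖ ≤ ε / 2 := by
    intro y hy hQy
    -- By convexity the midpoint stays in the neighbourhood, so `Q` there exceeds the supremum minus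
    -- `δ / 2`. The convexity inequality then leaves less than `δ` for half the difference.
    have hmid : (1 / 2 : ℝ) • (x₀ + y) ∈ V i₀ := by
      constructor
      · rw [norm_smul]
        have := norm_add_le x₀ y
        have h1 := hx₀.1
        have h2 := hy.1
        norm_num
        linarith
      · intro f hf
        have h1 := abs_lt.1 (hx₀.2 f hf)
        have h2 := abs_lt.1 (hy.2 f hf)
        rw [map_smul, map_add, smul_eq_mul, abs_lt]
        constructor <;> linarith
    have h1 := hdle i₀ _ hmid
    have h2 := hQ x₀ y
    have h3 := hδT ((1 / 2 : ℝ) • (x₀ - y)) (by linarith)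
    rw [map_smul, norm_smul] at h3
    norm_num at h3
    rw [map_sub]
    linarith
  refine ⟨_, ⟨T x₀, rfl⟩, lt_of_le_of_lt ?_ (half_lt_self hε)⟩
  rw [dist_eq_norm]
  refine ContinuousLinearMap.opNorm_le_bound _ (by positivity) fun g => ?_
  rw [_root_.sub_apply, NormedSpace.dual_def, conjOp_conjOp_apply, Real.norm_eq_abs]
  refine le_of_forall_pos_le_add fun τ hτ => ?_
  obtain ⟨y, hy, hQy⟩ := hnear
    (insert (g ∘L T) i₀.1, ⟨min i₀.2.1 τ, lt_min i₀.2.2 hτ⟩) (δ / 2) (half_pos hδ)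
  have hyV : y ∈ V i₀ := ⟨hy.1, fun f hf =>
    (hy.2 f (Finset.mem_insert_of_mem hf)).trans_le (min_le_left _ _)⟩
  have h1 := (hy.2 (g ∘L T) (Finset.mem_insert_self _ _)).trans_le (min_le_right _ _)
  have h2 := (g.le_opNorm (T (x₀ - y))).trans
    (mul_le_mul_of_nonneg_left (hclose y hyV hQy) (norm_nonneg g))
  rw [Real.norm_eq_abs, map_sub, map_sub] at h2
  rw [ContinuousLinearMap.comp_apply] at h1
  have h3 := abs_lt.1 h1
  have h4 := abs_le.1 h2
  rw [abs_le]
  constructor <;> linarith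

end Domination

theorem bidualCondition_pSummingOps {p : ℝ} (hp : 1 ≤ p) (Z : Type u) [NormedAddCommGroup Z]
    [NormedSpace ℝ Z] [CompleteSpace Z] : BidualCondition (pSummingOps p) Z := by
  intro T hT
  obtain ⟨C, hC, h⟩ := mem_pSummingOps_iff.1 hT
  have hp0 : 0 < p := by linarith
  -- Domination needs a strictly positive constant, whereas `C` may be `0`.
  have hD : 0 < C + 1 := by linarith
  have hDp : 0 < (C + 1) ^ p := Real.rpow_pos_of_pos hD p
  obtain ⟨Q, ⟨hQ, hQ'⟩, hTQ⟩ := exists_dominatingPair hp hD fun n x =>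
    (h n x).trans (mul_le_mul_of_nonneg_right (by linarith) (weakPNorm_nonneg x))
  have hmem : ∀ ξ : StrongDual ℝ (StrongDual ℝ Z), ‖ξ‖ ≤ 1 →
      conjOp (conjOp T) ξ ∈ Set.range (NormedSpace.inclusionInDoubleDual ℝ Z) := by
    intro ξ hξ
    rw [← isClosed_range_inclusionInDoubleDual.closure_eq]
    refine mem_closure_range_of_uniformlyConvex (Q := Q.2)
      (fun x => (sq_nonneg _).trans (hQ x).2.1) (fun x hx => (hQ x).2.2.trans
        (Real.rpow_le_one (norm_nonneg _) hx (by linarith))) hQ' (fun ε hε => ?_) hξ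
    have hεp : 0 < ε ^ p := Real.rpow_pos_of_pos hε p
    refine ⟨(((C + 1) ^ p)⁻¹ * ε ^ p) ^ 2, by positivity, fun x hx => ?_⟩
    have h1 : Q.1 x < ((C + 1) ^ p)⁻¹ * ε ^ p :=
      lt_of_pow_lt_pow_left₀ 2 (by positivity) ((hQ x).2.1.trans_lt hx)
    have h2 := (hTQ x).trans_lt (mul_lt_mul_of_pos_left h1 hDp)
    rw [mul_inv_cancel_left₀ hDp.ne'] at h2
    exact (Real.rpow_lt_rpow_iff (norm_nonneg _) hε.le hp0).1 h2
  obtain ⟨S, hS⟩ := exists_inclusion_comp_eq (conjOp (conjOp T)) fun ξ => by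
    obtain ⟨c, hc, hcξ⟩ := exists_pos_norm_inv_smul_le_one ξ
    obtain ⟨y, hy⟩ := hmem _ hcξ
    exact ⟨c • y, by rw [map_smul, hy, map_smul, smul_inv_smul₀ hc.ne']⟩
  exact ⟨S, mem_pSummingOps_iff.2 ⟨C * 2, by positivity, finPNorm_bidual_le hp hC h hS⟩, hS⟩

/-! ### Averaging operators on functions defined on a vector space -/

section Averaging

variable {X : Type u} [NormedAddCommGroup X] [NormedSpace ℝ X]

/-- The action of the group algebra `ℝ[X]` on `Z`-valued functions by translations. -/
noncomputable def translationAction (X Z : Type u) [AddCommGroup X] [AddCommGroup Z] [Module ℝ Z] :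
    AddMonoidAlgebra ℝ X →ₐ[ℝ] Module.End ℝ (X → Z) :=
  AddMonoidAlgebra.lift ℝ (Module.End ℝ (X → Z)) X
    { toFun := fun v => LinearMap.funLeft ℝ Z fun x => x + v.toAdd
      map_one' := by
        ext f x
        simp [LinearMap.funLeft]
      map_mul' := fun v w => by
        refine LinearMap.ext fun f => funext fun x => ?_
        simp [LinearMap.funLeft, add_comm, add_left_comm] }

/-- The group algebra element acting as the translation by `v`. -/
noncomputable def shift (v : X) : AddMonoidAlgebra ℝ X := AddMonoidAlgebra.single v 1

theorem shift_add (v w : X) : shift (v + w) = shift v * shift w := by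
  simp [shift]

theorem shift_natCast_smul (n : ℕ) (v : X) : shift ((n : ℝ) • v) = shift v ^ n := by
  rw [shift, shift, AddMonoidAlgebra.single_pow, one_pow, Nat.cast_smul_eq_nsmul]

/-- The average of the translations by `0, v, …, (N - 1) v`. -/
noncomputable def uniformAvg (v : X) (N : ℕ) : AddMonoidAlgebra ℝ X :=
  (N : ℝ)⁻¹ • ∑ k ∈ Finset.range N, shift ((k : ℝ) • v)

/-- A geometric sum: one small step after averaging equals `1 / N` times one long step. This gain is
the source of all the almost linearity below. -/
theorem shift_sub_one_mul_uniformAvg (v : X) (N : ℕ) :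
    (shift v - 1) * uniformAvg v N = (N : ℝ)⁻¹ • (shift ((N : ℝ) • v) - 1) := by
  simp only [uniformAvg, shift_natCast_smul, mul_smul_comm, mul_geom_sum]

section Action

variable {Z : Type u} [NormedAddCommGroup Z] [NormedSpace ℝ Z]

@[simp] theorem translationAction_shift_apply (v : X) (f : X → Z) (x : X) :
    translationAction X Z (shift v) f x = f (x + v) := by
  rw [translationAction, shift, AddMonoidAlgebra.lift_single, one_smul]
  rfl

theorem translationAction_mul_apply (q r : AddMonoidAlgebra ℝ X) (f : X → Z) :
    translationAction X Z (q * r) f = translationAction X Z q (translationAction X Z r f) := by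
  rw [map_mul]
  rfl

theorem translationAction_uniformAvg_apply (v : X) (N : ℕ) (f : X → Z) (x : X) :
    translationAction X Z (uniformAvg v N) f x =
      ∑ k ∈ Finset.range N, (N : ℝ)⁻¹ • f (x + (k : ℝ) • v) := by
  rw [uniformAvg, map_smul, map_sum, LinearMap.smul_apply, LinearMap.sum_apply, Pi.smul_apply,
    Finset.sum_apply, Finset.smul_sum]
  simp

theorem translationAction_shift_sub_one_mul_apply (v : X) (q : AddMonoidAlgebra ℝ X) (f : X → Z)
    (x : X) : translationAction X Z ((shift v - 1) * q) f x =
      translationAction X Z q f (x + v) - translationAction X Z q f x := by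
  rw [translationAction_mul_apply, map_sub, map_one, LinearMap.sub_apply, Pi.sub_apply,
    translationAction_shift_apply]
  rfl

theorem map_translationAction {W : Type u} [NormedAddCommGroup W] [NormedSpace ℝ W]
    (β : Z →L[ℝ] W) (q : AddMonoidAlgebra ℝ X) (f : X → Z) (x : X) :
    β (translationAction X Z q f x) = translationAction X W q (fun y => β (f y)) x := by
  induction q using AddMonoidAlgebra.induction_linear with
  | zero => simp
  | add q r hq hr => simp [hq, hr]
  | single v c =>
    have h : AddMonoidAlgebra.single v c = c • shift v := by simp [shift]
    rw [h, map_smul, map_smul, LinearMap.smul_apply, LinearMap.smul_apply, Pi.smul_apply,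
      Pi.smul_apply, map_smul, translationAction_shift_apply, translationAction_shift_apply]

end Action

/-- `q` acts as an average of translations of mean length at most `d`. -/
structure IsAveraging (q : AddMonoidAlgebra ℝ X) (d : ℝ) : Prop where
  sub_mem : ∀ (Z : Type u) [NormedAddCommGroup Z] [NormedSpace ℝ Z] (C : Set Z), Convex ℝ C →
    ∀ (f : X → Z) (x y : X), (∀ u, f (x + u) - f (y + u) ∈ C) →
      ∀ u, translationAction X Z q f (x + u) - translationAction X Z q f (y + u) ∈ C
  norm_apply_sub_le : ∀ (Z : Type u) [NormedAddCommGroup Z] [NormedSpace ℝ Z] (f : X → Z),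
    (∀ x y, ‖f x - f y‖ ≤ ‖x - y‖) → ∀ x, ‖translationAction X Z q f x - f x‖ ≤ d

namespace IsAveraging

variable {q r : AddMonoidAlgebra ℝ X} {d e : ℝ} {Z : Type u} [NormedAddCommGroup Z]
  [NormedSpace ℝ Z]

/-- `sub_mem` is applied to a ball. Applied to a singleton, it later shows that averaging preserves
the increments of the identity exactly. -/
theorem lipschitz (hq : IsAveraging q d) {f : X → Z} (hf : ∀ x y, ‖f x - f y‖ ≤ ‖x - y‖) (x y : X) :
    ‖translationAction X Z q f x - translationAction X Z q f y‖ ≤ ‖x - y‖ := by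
  have := hq.sub_mem Z (Metric.closedBall 0 ‖x - y‖) (convex_closedBall _ _) f x y
    (fun u => by simpa using hf (x + u) (y + u)) 0
  simpa using this

theorem one : IsAveraging (1 : AddMonoidAlgebra ℝ X) 0 :=
  ⟨fun Z _ _ C _ f x y h u => by simpa using h u, fun Z _ _ f _ x => by simp⟩

theorem mul (hq : IsAveraging q d) (hr : IsAveraging r e) : IsAveraging (q * r) (d + e) := by
  refine ⟨fun Z _ _ C hC f x y h u => ?_, fun Z _ _ f hf x => ?_⟩
  · rw [translationAction_mul_apply]
    exact hq.sub_mem Z C hC _ x y (hr.sub_mem Z C hC f x y h) u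
  · rw [translationAction_mul_apply]
    calc _ ≤ ‖translationAction X Z q (translationAction X Z r f) x - translationAction X Z r f x‖
          + ‖translationAction X Z r f x - f x‖ := norm_sub_le_norm_sub_add_norm_sub _ _ _
      _ ≤ d + e := add_le_add (hq.norm_apply_sub_le Z _ (hr.lipschitz hf) x) (hr.norm_apply_sub_le Z f hf x)

theorem prod {ι : Type*} (s : Finset ι) {q : ι → AddMonoidAlgebra ℝ X} {d : ι → ℝ}
    (h : ∀ i ∈ s, IsAveraging (q i) (d i)) : IsAveraging (∏ i ∈ s, q i) (∑ i ∈ s, d i) := by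
  classical
  induction s using Finset.induction_on with
  | empty => simpa using one
  | insert a s ha ih =>
    rw [Finset.prod_insert ha, Finset.sum_insert ha]
    exact (h a (Finset.mem_insert_self _ _)).mul
      (ih fun i hi => h i (Finset.mem_insert_of_mem hi))

theorem uniformAvg (v : X) {N : ℕ} (hN : 0 < N) : IsAveraging (uniformAvg v N) (N * ‖v‖) := by
  have hN' : (0 : ℝ) < N := Nat.cast_pos.2 hN
  have hsum : ∑ _k ∈ Finset.range N, (N : ℝ)⁻¹ = 1 := by simp [hN'.ne']
  refine ⟨fun Z _ _ C hC f x y h u => ?_, fun Z _ _ f hf x => ?_⟩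
  · rw [translationAction_uniformAvg_apply, translationAction_uniformAvg_apply,
      ← Finset.sum_sub_distrib]
    simp only [← smul_sub, add_assoc]
    exact hC.sum_mem (fun _ _ => (inv_pos.2 hN').le) hsum fun k _ => h _
  · have : f x = ∑ k ∈ Finset.range N, (N : ℝ)⁻¹ • f x := by
      rw [← Finset.sum_smul, hsum, one_smul]
    rw [translationAction_uniformAvg_apply]
    conv_lhs => rw [this]
    rw [← Finset.sum_sub_distrib]
    refine (norm_sum_le _ _).trans ?_
    calc ∑ k ∈ Finset.range N, ‖(N : ℝ)⁻¹ • f (x + (k : ℝ) • v) - (N : ℝ)⁻¹ • f x‖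
        ≤ ∑ _k ∈ Finset.range N, (N : ℝ)⁻¹ * (N * ‖v‖) := by
          refine Finset.sum_le_sum fun k hk => ?_
          rw [← smul_sub, norm_smul, norm_inv, Real.norm_natCast]
          refine mul_le_mul_of_nonneg_left ((hf _ _).trans ?_) (inv_pos.2 hN').le
          rw [add_sub_cancel_left, norm_smul, Real.norm_natCast]
          gcongr
          exact (Finset.mem_range.1 hk).le
      _ = N * ‖v‖ := by rw [← Finset.sum_mul, hsum, one_mul]

theorem norm_shift_sub_one_mul_le (hq : IsAveraging q d)
    {f : X → Z} (hf : ∀ x y, ‖f x - f y‖ ≤ ‖x - y‖) (v x : X) :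
    ‖translationAction X Z ((shift v - 1) * q) f x‖ ≤ ‖v‖ := by
  rw [translationAction_shift_sub_one_mul_apply]
  simpa using hq.lipschitz hf (x + v) x

/-- Only the increment `w` is estimated; the bound is uniform in `v`, which may be a long step
produced by telescoping. -/
theorem norm_second_difference_le (hq : IsAveraging q d)
    {f : X → Z} (hf : ∀ x y, ‖f x - f y‖ ≤ ‖x - y‖) (v w x : X) :
    ‖translationAction X Z ((shift v - 1) * ((shift w - 1) * q)) f x‖ ≤ 2 * ‖w‖ := by
  rw [translationAction_shift_sub_one_mul_apply, two_mul]
  exact (norm_sub_le _ _).trans (add_le_add (hq.norm_shift_sub_one_mul_le hf _ _)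
    (hq.norm_shift_sub_one_mul_le hf _ _))

/-- Dropping an averaging factor moves each of the two values in the difference by at most its mean
length `e`. -/
theorem norm_shift_sub_one_mul_mul_sub_le (hq : IsAveraging q d) (hr : IsAveraging r e)
    {f : X → Z} (hf : ∀ x y, ‖f x - f y‖ ≤ ‖x - y‖) (v x : X) :
    ‖translationAction X Z ((shift v - 1) * (r * q)) f x -
      translationAction X Z ((shift v - 1) * q) f x‖ ≤ 2 * e := by
  rw [translationAction_shift_sub_one_mul_apply, translationAction_shift_sub_one_mul_apply,
    translationAction_mul_apply, sub_sub_sub_comm, two_mul]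
  exact (norm_sub_le _ _).trans (add_le_add (hr.norm_apply_sub_le Z _ (hq.lipschitz hf) _)
    (hr.norm_apply_sub_le Z _ (hq.lipschitz hf) _))

end IsAveraging

end Averaging

/-! ### Linear liftings into the bidual -/

section Lifting

variable {X Z : Type u} [NormedAddCommGroup X] [NormedSpace ℝ X]
  [NormedAddCommGroup Z] [NormedSpace ℝ Z]

/-- The order of choice matters: `L` depends only on `s` and `ε`; `K` depends on `η`; `M` comes
last, so that even `K` steps of size `1 / (L M)` are short. -/
theorem exists_uniformAvg_parameters (s : Finset X) {ε : ℝ} (hε : 0 < ε) :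
    ∃ L : ℕ, 0 < L ∧ ∑ v ∈ s, (L : ℝ)⁻¹ * ‖v‖ ≤ ε ∧
      ∀ (G : Finset X) (η : ℝ), 0 < η → ∃ K M : ℕ, 0 < K ∧ 0 < M ∧ (K : ℝ)⁻¹ ≤ η ∧
        ((L : ℝ) * M)⁻¹ ≤ η ∧ ∑ v ∈ G, K * ((L : ℝ) * M)⁻¹ * ‖v‖ ≤ ε := by
  have aux : ∀ (B δ : ℝ), 0 < δ → ∃ N : ℕ, 0 < N ∧ ∀ n : ℕ, N ≤ n → (n : ℝ)⁻¹ * B ≤ δ := by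
    intro B δ hδ
    obtain ⟨N, hN⟩ := exists_nat_ge (B / δ)
    refine ⟨N + 1, N.succ_pos, fun n hn => ?_⟩
    have hnpos : (0 : ℝ) < n := Nat.cast_pos.2 (N.succ_pos.trans_le hn)
    rw [inv_mul_le_iff₀ hnpos]
    rw [div_le_iff₀ hδ] at hN
    refine hN.trans (mul_le_mul_of_nonneg_right ?_ hδ.le)
    exact_mod_cast (Nat.le_succ N).trans hn
  obtain ⟨L, hL, hL'⟩ := aux (∑ v ∈ s, ‖v‖) ε hε
  refine ⟨L, hL, by rw [← Finset.mul_sum]; exact hL' L le_rfl, fun G η hη => ?_⟩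
  obtain ⟨K, hK, hK'⟩ := aux 1 η hη
  obtain ⟨M₁, hM₁, hM₁'⟩ := aux 1 η hη
  obtain ⟨M₂, hM₂, hM₂'⟩ := aux (K * ∑ v ∈ G, ‖v‖) ε hε
  have hle : ∀ n, n ≤ L * n := fun n => Nat.le_mul_of_pos_left n hL
  refine ⟨K, max M₁ M₂, hK, hM₁.trans_le (le_max_left _ _), by simpa using hK' K le_rfl, ?_, ?_⟩
  · have := hM₁' (L * max M₁ M₂) ((le_max_left _ _).trans (hle _))
    push_cast at this ⊢
    simpa using this
  · have := hM₂' (L * max M₁ M₂) ((le_max_right _ _).trans (hle _))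
    rw [← Finset.mul_sum]
    push_cast at this ⊢
    rwa [mul_assoc, mul_left_comm]

/-- Near each finite set, a Lipschitz map is the restriction of an almost linear map, up to the
averaged differences `z`. -/
theorem exists_almost_linear {δ : X → Z} (hδ : ∀ x y, ‖δ x - δ y‖ ≤ ‖x - y‖) (s : Finset X)
    {ε : ℝ} (hε : 0 < ε) :
    ∃ (q : X → AddMonoidAlgebra ℝ X) (d : X → ℝ), (∀ x, IsAveraging (q x) (d x)) ∧
      ∀ (F : Finset X) (η : ℝ), 0 < η → ∃ M : X → Z, (∀ x, ‖M x‖ ≤ ‖x‖) ∧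
        (∀ x ∈ F, ∀ y, ‖M (x + y) - M x - M y‖ ≤ η * ‖y‖) ∧
        ∀ x ∈ s, ‖M x - translationAction X Z ((shift x - 1) * q x) δ 0‖ ≤ ε := by
  classical
  obtain ⟨L, hL, hLs, hKM⟩ := exists_uniformAvg_parameters s (show 0 < ε / 4 by positivity)
  have hL' : (0 : ℝ) < L := Nat.cast_pos.2 hL
  -- Coarse averages over whole segments `[0, v)`. They need not be short, but depend only on `s`
  -- and `ε`, so the limit objects built from `q` do not move with `F` and `η`.
  let c : X → AddMonoidAlgebra ℝ X := fun v => uniformAvg ((L : ℝ)⁻¹ • v) L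
  have hc : ∀ v, IsAveraging (c v) (L * ‖(L : ℝ)⁻¹ • v‖) := fun v => IsAveraging.uniformAvg _ hL
  refine ⟨fun x => ∏ v ∈ s.erase x, c v, _, fun x => IsAveraging.prod _ fun v _ => hc v, ?_⟩
  intro F η hη
  obtain ⟨K, M, hK, hM, hKη, hrη, hr⟩ := hKM (F ∪ s) (η / 2) (half_pos hη)
  have hK' : (0 : ℝ) < K := Nat.cast_pos.2 hK
  have hM' : (0 : ℝ) < M := Nat.cast_pos.2 hM
  set r : ℝ := ((L : ℝ) * M)⁻¹ with hrdef
  have hr0 : 0 < r := by positivity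
  set G := F ∪ s with hG
  -- Fine averages of small total mean length. For `v ∈ s` the `M` steps of size `r` span exactly
  -- one coarse step, so fine and coarse telescoping compose.
  let b : X → AddMonoidAlgebra ℝ X := fun v => uniformAvg (r • v) (if v ∈ s then M else K)
  let db : X → ℝ := fun v => (if v ∈ s then (L : ℝ)⁻¹ * ‖v‖ else 0) + K * r * ‖v‖
  have hb : ∀ v, IsAveraging (b v) ((if v ∈ s then M else K : ℕ) * ‖r • v‖) := fun v =>
    IsAveraging.uniformAvg _ (by split_ifs <;> assumption)
  have hbd : ∀ v, ((if v ∈ s then M else K : ℕ) : ℝ) * ‖r • v‖ ≤ db v := by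
    intro v
    rw [norm_smul, Real.norm_of_nonneg hr0.le]
    by_cases hv : v ∈ s
    · simp only [hv, if_true, db]
      have : (M : ℝ) * (r * ‖v‖) = (L : ℝ)⁻¹ * ‖v‖ := by
        rw [hrdef]
        field_simp
      rw [this]
      have : 0 ≤ K * r * ‖v‖ := by positivity
      linarith
    · simp only [hv, if_false, db]
      linarith
  let c' : X → AddMonoidAlgebra ℝ X := fun v => if v ∈ s then c v else 1
  have hc' : ∀ v, ∃ d, IsAveraging (c' v) d := fun v => by
    by_cases hv : v ∈ s
    · simpa only [c', hv, if_true] using ⟨_, hc v⟩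
    · simpa only [c', hv, if_false] using ⟨0, IsAveraging.one⟩
  choose d' hd' using hc'
  let a : X → AddMonoidAlgebra ℝ X := fun v => c' v * b v
  have ha := fun v => (hd' v).mul (hb v)
  have htele_s : ∀ v ∈ s, (shift (r • v) - 1) * a v = r • (shift v - 1) := by
    intro v hv
    have h1 : (M : ℝ) • r • v = (L : ℝ)⁻¹ • v := by
      rw [smul_smul, hrdef]
      congr 1
      field_simp
    have h2 : (L : ℝ) • (L : ℝ)⁻¹ • v = v := smul_inv_smul₀ hL'.ne' v
    simp only [a, b, c', c, hv, if_true]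
    rw [mul_left_comm, shift_sub_one_mul_uniformAvg, h1, mul_smul_comm, mul_comm,
      shift_sub_one_mul_uniformAvg, h2, smul_smul, hrdef, mul_inv, mul_comm]
  have htele : ∀ v, ∃ (κ : ℝ) (w : X), 0 ≤ κ ∧ κ ≤ η / 2 ∧
      (shift (r • v) - 1) * a v = κ • (shift w - 1) := by
    intro v
    by_cases hv : v ∈ s
    · exact ⟨r, v, hr0.le, hrη, htele_s v hv⟩
    · refine ⟨(K : ℝ)⁻¹, (K : ℝ) • r • v, by positivity, hKη, ?_⟩
      simp only [a, b, c', hv, if_false, one_mul]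
      exact shift_sub_one_mul_uniformAvg _ _
  have hP := fun H : Finset X => IsAveraging.prod H fun v _ => ha v
  -- The almost linear map is the difference quotient at scale `r` of the fully averaged `δ`.
  refine ⟨fun x => r⁻¹ • translationAction X Z ((shift (r • x) - 1) * ∏ v ∈ G, a v) δ 0,
    fun x => ?_, fun x hx y => ?_, fun x hx => ?_⟩
  · rw [norm_smul, norm_inv, Real.norm_of_nonneg hr0.le, inv_mul_le_iff₀ hr0]
    refine ((hP G).norm_shift_sub_one_mul_le hδ _ _).trans_eq ?_
    rw [norm_smul, Real.norm_of_nonneg hr0.le]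
  · obtain ⟨κ, w, hκ, hκη, hw⟩ := htele x
    have hxG : x ∈ G := Finset.mem_union_left _ hx
    -- The additivity defect is the product of two difference operators; the one for `x` telescopes
    -- against `a x` and yields the small factor `κ`.
    have halg : (shift (r • (x + y)) - 1) * ∏ v ∈ G, a v - (shift (r • x) - 1) * ∏ v ∈ G, a v -
        (shift (r • y) - 1) * ∏ v ∈ G, a v =
        κ • ((shift w - 1) * ((shift (r • y) - 1) * ∏ v ∈ G.erase x, a v)) := by
      rw [← Finset.mul_prod_erase G a hxG, smul_add, shift_add, ← smul_mul_assoc, ← hw]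
      ring
    rw [← smul_sub, ← smul_sub, ← Pi.sub_apply, ← Pi.sub_apply, ← LinearMap.sub_apply,
      ← LinearMap.sub_apply, ← map_sub, ← map_sub, halg, map_smul, LinearMap.smul_apply,
      Pi.smul_apply, norm_smul, norm_smul, norm_inv, Real.norm_of_nonneg hr0.le,
      Real.norm_of_nonneg hκ]
    have h := (hP (G.erase x)).norm_second_difference_le hδ w (r • y) 0
    rw [norm_smul, Real.norm_of_nonneg hr0.le] at h
    calc _ ≤ r⁻¹ * (η / 2 * (2 * (r * ‖y‖))) := by gcongr
      _ = η * ‖y‖ := by field_simp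
  · have hxG : x ∈ G := Finset.mem_union_right _ hx
    have halg : (shift (r • x) - 1) * ∏ v ∈ G, a v =
        r • ((shift x - 1) * ((∏ v ∈ G.erase x, b v) * ∏ v ∈ s.erase x, c v)) := by
      have h1 : ∏ v ∈ G.erase x, c' v = ∏ v ∈ s.erase x, c v := by
        rw [← Finset.prod_subset (Finset.erase_subset_erase x Finset.subset_union_right)]
        · exact Finset.prod_congr rfl fun v hv => if_pos (Finset.mem_of_mem_erase hv)
        · intro v hv hv'
          refine if_neg fun hvs => hv' (Finset.mem_erase.2 ⟨(Finset.mem_erase.1 hv).1, hvs⟩)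
      rw [← Finset.mul_prod_erase G a hxG, ← mul_assoc, htele_s x hx, Finset.prod_mul_distrib, h1,
        smul_mul_assoc, mul_comm (∏ v ∈ s.erase x, c v)]
    beta_reduce
    rw [halg, map_smul, LinearMap.smul_apply, Pi.smul_apply, inv_smul_smul₀ hr0.ne']
    -- The fine averages are discarded at cost twice their total mean length, which is at most `ε /
    -- 4 + ε / 4`.
    refine ((IsAveraging.prod (s.erase x) fun v _ => hc v).norm_shift_sub_one_mul_mul_sub_le
      (IsAveraging.prod (G.erase x) fun v _ => hb v) hδ x 0).trans ?_
    have h1 : ∑ v ∈ G.erase x, ((if v ∈ s then M else K : ℕ) : ℝ) * ‖r • v‖ ≤ ∑ v ∈ G, db v :=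
      (Finset.sum_le_sum_of_subset_of_nonneg (Finset.erase_subset x G)
        fun v _ _ => by positivity).trans (Finset.sum_le_sum fun v _ => hbd v)
    have h2 : ∑ v ∈ G, (if v ∈ s then (L : ℝ)⁻¹ * ‖v‖ else 0) = ∑ v ∈ s, (L : ℝ)⁻¹ * ‖v‖ := by
      rw [← Finset.sum_filter]
      refine Finset.sum_congr ?_ fun _ _ => rfl
      ext v
      simp only [Finset.mem_filter, hG, Finset.mem_union]
      tauto
    rw [Finset.sum_add_distrib, h2] at h1
    linarith

/-- Limits of almost linear maps along a directed family are linear maps into the bidual. -/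
theorem exists_clm_bidual_of_almost_linear {ι : Type*} {l : Filter ι} [l.NeBot] (M : ι → X → Z)
    (hM : ∀ i x, ‖M i x‖ ≤ ‖x‖)
    (hadd : ∀ x y, Tendsto (fun i => ‖M i (x + y) - M i x - M i y‖) l (𝓝 0)) :
    ∃ R : X →L[ℝ] StrongDual ℝ (StrongDual ℝ Z), ‖R‖ ≤ 1 ∧ ∀ (x : X) (z : Z) (ε : ℝ),
      (∀ i, ‖M i x - z‖ ≤ ε) → ‖R x - NormedSpace.inclusionInDoubleDual ℝ Z z‖ ≤ ε := by
  -- An ultrafilter makes all the bounded scalar families `φ (M i x)` converge simultaneously.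
  let U : Ultrafilter ι := Ultrafilter.of l
  have hU : (U : Filter ι) ≤ l := Ultrafilter.of_le l
  have hlim : ∀ (x : X) (φ : StrongDual ℝ Z), ∃ t : ℝ, Tendsto (fun i => φ (M i x)) U (𝓝 t) := by
    intro x φ
    obtain ⟨t, -, ht⟩ := (isCompact_closedBall (0 : ℝ) (‖φ‖ * ‖x‖)).ultrafilter_le_nhds
      (U.map fun i => φ (M i x)) (by
        rw [le_principal_iff]
        refine Filter.mem_map.2 (Filter.univ_mem' fun i => ?_)
        rw [Set.mem_preimage, mem_closedBall_zero_iff]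
        exact (φ.le_opNorm _).trans (mul_le_mul_of_nonneg_left (hM i x) (norm_nonneg _)))
    exact ⟨t, ht⟩
  choose t ht using hlim
  have htn : ∀ x φ, ‖t x φ‖ ≤ ‖φ‖ * ‖x‖ := fun x φ =>
    le_of_tendsto (ht x φ).norm (Eventually.of_forall fun i =>
      (φ.le_opNorm _).trans (mul_le_mul_of_nonneg_left (hM i x) (norm_nonneg _)))
  let R₀ : X → StrongDual ℝ (StrongDual ℝ Z) := fun x => LinearMap.mkContinuous
    { toFun := t x
      map_add' := fun φ ψ => tendsto_nhds_unique (ht x (φ + ψ)) ((ht x φ).add (ht x ψ))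
      map_smul' := fun a φ => tendsto_nhds_unique (ht x (a • φ)) ((ht x φ).const_mul a) }
    ‖x‖ fun φ => by
      rw [mul_comm]
      exact htn x φ
  have hR₀ : ∀ x φ, R₀ x φ = t x φ := fun _ _ => rfl
  have hR₀n : ∀ x, ‖R₀ x‖ ≤ ‖x‖ := fun x => LinearMap.mkContinuous_norm_le _ (norm_nonneg x) _
  have hR₀add : ∀ x y, R₀ (x + y) = R₀ x + R₀ y := by
    intro x y
    ext φ
    rw [_root_.add_apply, hR₀, hR₀, hR₀, ← sub_eq_zero, ← sub_sub]
    refine tendsto_nhds_unique (((ht (x + y) φ).sub (ht x φ)).sub (ht y φ)) ?_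
    rw [tendsto_zero_iff_norm_tendsto_zero]
    refine squeeze_zero (fun _ => norm_nonneg _) (fun i => ?_)
      (by simpa using ((hadd x y).mono_left hU).const_mul ‖φ‖)
    rw [← map_sub, ← map_sub]
    exact φ.le_opNorm _
  -- Real homogeneity need not be checked: it follows from additivity and continuity.
  let R₁ : X →+ StrongDual ℝ (StrongDual ℝ Z) := AddMonoidHom.mk' R₀ hR₀add
  have hcont : Continuous R₁ := AddMonoidHomClass.continuous_of_bound R₁ 1 fun x => by
    rw [one_mul]
    exact hR₀n x
  refine ⟨R₁.toRealLinearMap hcont, ContinuousLinearMap.opNorm_le_bound _ zero_le_one fun x => by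
    rw [one_mul]; exact hR₀n x, fun x z ε h => ?_⟩
  obtain ⟨i⟩ := l.nonempty_of_neBot
  have hε : 0 ≤ ε := (norm_nonneg _).trans (h i)
  refine ContinuousLinearMap.opNorm_le_bound _ hε fun φ => ?_
  rw [_root_.sub_apply, NormedSpace.dual_def]
  change ‖t x φ - φ z‖ ≤ _
  refine le_of_tendsto ((ht x φ).sub_const (φ z)).norm (Eventually.of_forall fun i => ?_)
  rw [← map_sub, mul_comm]
  exact (φ.le_opNorm _).trans (mul_le_mul_of_nonneg_left (h i) (norm_nonneg _))

/-- A Lipschitz map `δ : X → Z` has linear approximations with values in the bidual which, on a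
given finite set, almost agree with averaged differences of `δ`. -/
theorem exists_linear_lifting {δ : X → Z} (hδ : ∀ x y, ‖δ x - δ y‖ ≤ ‖x - y‖) (s : Finset X)
    {ε : ℝ} (hε : 0 < ε) :
    ∃ (q : X → AddMonoidAlgebra ℝ X) (d : X → ℝ), (∀ x, IsAveraging (q x) (d x)) ∧
      ∃ R : X →L[ℝ] StrongDual ℝ (StrongDual ℝ Z), ‖R‖ ≤ 1 ∧ ∀ x ∈ s,
        ‖R x - NormedSpace.inclusionInDoubleDual ℝ Z
          (translationAction X Z ((shift x - 1) * q x) δ 0)‖ ≤ ε := by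
  classical
  obtain ⟨q, d, hq, h⟩ := exists_almost_linear hδ s hε
  refine ⟨q, d, hq, ?_⟩
  choose M hM1 hM2 hM3 using fun i : Finset X × ℕ => h i.1 (1 / ((i.2 : ℝ) + 1)) (by positivity)
  obtain ⟨R, hR, hRz⟩ := exists_clm_bidual_of_almost_linear (l := atTop) M hM1 fun x y => by
    refine squeeze_zero' (g := fun i : Finset X × ℕ => 1 / ((i.2 : ℝ) + 1) * ‖y‖)
      (Eventually.of_forall fun _ => norm_nonneg _) ?_ ?_
    · filter_upwards [eventually_ge_atTop (({x}, 0) : Finset X × ℕ)] with i hi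
      exact hM2 i x (hi.1 (Finset.mem_singleton_self x)) y
    · have h1 : Tendsto (fun i : Finset X × ℕ => i.2) atTop atTop := by
        rw [← prod_atTop_atTop_eq]
        exact tendsto_snd
      simpa using (tendsto_one_div_add_atTop_nhds_zero_nat.comp h1).mul_const ‖y‖
  exact ⟨R, hR, fun x hx => hRz x _ ε fun i => hM3 i x hx⟩

end Lifting

/-! ### The Lipschitz-free space -/

section LipFree

variable {X : Type u} [NormedAddCommGroup X] [NormedSpace ℝ X]

/-- The canonical embedding `x ↦ δ_x` of `X` into its Lipschitz-free space. -/
noncomputable def LipFree.of (x : X) : LipFree X :=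
  ⟨LipZero.eval x, Submodule.le_topologicalClosure _ (Submodule.subset_span ⟨x, rfl⟩)⟩

theorem LipFree.norm_of_sub_of_le (x y : X) : ‖LipFree.of x - LipFree.of y‖ ≤ ‖x - y‖ := by
  change ‖LipZero.eval x - LipZero.eval y‖ ≤ _
  refine ContinuousLinearMap.opNorm_le_bound _ (norm_nonneg _) fun f => ?_
  rw [mul_comm]
  exact LipZero.abs_sub_le f x y

/-- A continuous linear functional, as a Lipschitz function. -/
noncomputable def dualToLipZero (X : Type u) [NormedAddCommGroup X] [NormedSpace ℝ X] :
    StrongDual ℝ X →L[ℝ] LipZero X :=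
  LinearMap.mkContinuous
    { toFun := fun φ => ⟨φ, map_zero φ, ‖φ‖₊, φ.lipschitz⟩
      map_add' := fun _ _ => rfl
      map_smul' := fun _ _ => rfl }
    1 fun φ => by
      rw [one_mul]
      refine LipZero.norm_le_of _ (norm_nonneg _) fun x y => ?_
      change ‖φ x - φ y‖ ≤ _
      rw [← map_sub]
      exact φ.le_opNorm _

theorem norm_dualToLipZero_le : ‖dualToLipZero X‖ ≤ 1 :=
  LinearMap.mkContinuous_norm_le _ zero_le_one _

/-- The barycenter map of the Lipschitz-free space of a Banach space. -/
theorem LipFree.exists_barycenter [CompleteSpace X] :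
    ∃ β : LipFree X →L[ℝ] X, ‖β‖ ≤ 1 ∧ ∀ x, β (LipFree.of x) = x := by
  let j := NormedSpace.inclusionInDoubleDual ℝ X
  let B : StrongDual ℝ (LipZero X) →L[ℝ] StrongDual ℝ (StrongDual ℝ X) :=
    ContinuousLinearMap.precomp ℝ (dualToLipZero X)
  have hBn : ∀ m, ‖B m‖ ≤ ‖m‖ := fun m =>
    (m.opNorm_comp_le (dualToLipZero X)).trans
      (mul_le_of_le_one_right (norm_nonneg _) norm_dualToLipZero_le)
  have hB : ∀ x, B (LipZero.eval x) = j x := fun x => rfl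
  -- Restriction to linear functionals sends each `δ_x` to `j x`, and `j(X)` is closed, so the whole
  -- closed span lands in `j(X)`.
  have hrange : ∀ m : LipFree X, B m ∈ Set.range j := by
    have hle : (Submodule.span ℝ (Set.range (LipZero.eval (X := X)))).topologicalClosure ≤
        (LinearMap.range (j : X →ₗ[ℝ] _)).comap B.toLinearMap := by
      refine Submodule.topologicalClosure_minimal _ ?_ ?_
      · rw [Submodule.span_le]
        rintro _ ⟨x, rfl⟩
        exact ⟨x, (hB x).symm⟩
      · exact isClosed_range_inclusionInDoubleDual.preimage B.continuous
    exact fun m => hle m.2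
  obtain ⟨β, hβ⟩ := exists_inclusion_comp_eq (B ∘L Submodule.subtypeL _) hrange
  have hβ' : ∀ m : LipFree X, j (β m) = B m := fun m => DFunLike.congr_fun hβ m
  refine ⟨β, ContinuousLinearMap.opNorm_le_bound _ zero_le_one fun m => ?_, fun x => ?_⟩
  · rw [one_mul, ← norm_inclusionInDoubleDual_apply]
    change ‖j (β m)‖ ≤ _
    rw [hβ']
    exact hBn m
  · refine (NormedSpace.inclusionInDoubleDualLi ℝ).injective ?_
    exact hβ' (LipFree.of x)

/-- Averaged differences of a section of a linear map are lifts. -/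
theorem IsAveraging.map_shift_sub_one_mul {Z : Type u} [NormedAddCommGroup Z] [NormedSpace ℝ Z]
    {q : AddMonoidAlgebra ℝ X} {d : ℝ} (hq : IsAveraging q d) {δ : X → Z} (β : Z →L[ℝ] X)
    (hβ : ∀ x, β (δ x) = x) (v : X) :
    β (translationAction X Z ((shift v - 1) * q) δ 0) = v := by
  rw [map_translationAction, translationAction_shift_sub_one_mul_apply]
  have h := hq.sub_mem X {v} (convex_singleton v) (fun y => β (δ y)) v 0
    (fun u => by simp [hβ]) 0
  simpa using h

end LipFree

/-! ### The bounded approximation property -/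

section BAP

variable {X : Type u} [NormedAddCommGroup X] [NormedSpace ℝ X] [CompleteSpace X]

theorem hasBAP_iff {A : OperatorClass.{u}} {l : ℝ} :
    HasBAP A l X ↔ ∀ K : Set X, IsCompact K → ∀ ε > 0,
      ∃ T ∈ A X X, ‖T‖ ≤ l ∧ ∀ x ∈ K, ‖T x - x‖ < ε := by
  rw [HasBAP, mem_closure_iff_nhds_basis (nhds_basis_uniformity
    Metric.uniformity_basis_dist.compactConvergenceUniformity)]
  simp only [Set.exists_mem_image, Prod.forall, Set.mem_ofPred_eq, dist_eq_norm]
  exact ⟨fun h K hK ε hε => let ⟨T, hT, hTK⟩ := h K ε ⟨hK, hε⟩; ⟨T, hT.1, hT.2, hTK⟩,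
    fun h K ε hKε => let ⟨T, hTA, hTl, hTK⟩ := h K hKε.1 ε hKε.2; ⟨T, ⟨hTA, hTl⟩, hTK⟩⟩

theorem HasBAP.of_lipFree {A : OperatorClass.{u}} (hA : IsOperatorIdeal A)
    (hb : BidualCondition A (LipFree X)) {l : ℝ} (hl : 1 ≤ l) (h : HasBAP A l (LipFree X)) :
    HasBAP A l X := by
  rw [hasBAP_iff] at h ⊢
  intro K hK ε hε
  have hl0 : 0 < l := zero_lt_one.trans_le hl
  -- The four errors: replacing `x` by a net point `y`, before and after applying the operator; the
  -- lifting error scaled by `l`; and the error of `T` at `z y`.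
  obtain ⟨η, hη, hηε⟩ : ∃ η > 0, l * η + η + l * η + η < ε :=
    ⟨ε / (2 * l + 3), by positivity, by
      have : l * (ε / (2 * l + 3)) + ε / (2 * l + 3) + l * (ε / (2 * l + 3)) + ε / (2 * l + 3) =
        (2 * l + 2) / (2 * l + 3) * ε := by ring
      rw [this]
      exact mul_lt_of_lt_one_left hε ((div_lt_one (by positivity)).2 (by linarith))⟩
  obtain ⟨s, -, hsf, hsK⟩ := hK.finite_cover_balls hη
  obtain ⟨β, hβn, hβ⟩ := LipFree.exists_barycenter (X := X)
  obtain ⟨q, d, hq, R, hR, hRs⟩ :=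
    exists_linear_lifting (LipFree.norm_of_sub_of_le (X := X)) hsf.toFinset hη
  set z : X → LipFree X := fun x =>
    translationAction X (LipFree X) ((shift x - 1) * q x) LipFree.of 0
  obtain ⟨T, hTA, hTl, hT⟩ := h (z '' s) (hsf.image z).isCompact η hη
  obtain ⟨S, hSA, hS⟩ := hb T hTA
  have hSl : ‖S‖ ≤ l := (norm_le_of_inclusion_comp_eq hS).trans hTl
  have hSj : ∀ m, S (NormedSpace.inclusionInDoubleDual ℝ _ m) = T m := fun m =>
    (NormedSpace.inclusionInDoubleDualLi ℝ).injective
      (DFunLike.congr_fun hS (NormedSpace.inclusionInDoubleDual ℝ _ m))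
  have hβS : ∀ ξ, ‖β (S ξ)‖ ≤ l * ‖ξ‖ := fun ξ =>
    (β.le_of_opNorm_le hβn _).trans (by rw [one_mul]; exact S.le_of_opNorm_le hSl ξ)
  have hU : ∀ x, ‖β (S (R x))‖ ≤ l * ‖x‖ := fun x =>
    (hβS _).trans (mul_le_mul_of_nonneg_left
      ((R.le_of_opNorm_le hR x).trans_eq (one_mul _)) hl0.le)
  refine ⟨β ∘L S ∘L R, hA.comp_mem _ _ _ _ R S β hSA,
    ContinuousLinearMap.opNorm_le_bound _ hl0.le hU, fun x hx => ?_⟩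
  obtain ⟨y, hy, hxy⟩ := Set.mem_iUnion₂.1 (hsK hx)
  have hxy' : ‖x - y‖ < η := mem_ball_iff_norm.1 hxy
  have hβz : β (z y) = y := (hq y).map_shift_sub_one_mul β hβ y
  have h1 : ‖β (S (R (x - y)))‖ ≤ l * η :=
    (hU _).trans (mul_le_mul_of_nonneg_left hxy'.le hl0.le)
  have h2 : ‖β (S (R y - NormedSpace.inclusionInDoubleDual ℝ _ (z y)))‖ ≤ l * η :=
    (hβS _).trans (mul_le_mul_of_nonneg_left (hRs y (hsf.mem_toFinset.2 hy)) hl0.le)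
  have h3 : ‖β (T (z y) - z y)‖ ≤ η :=
    (β.le_of_opNorm_le hβn _).trans (by rw [one_mul]; exact (hT _ ⟨y, hy, rfl⟩).le)
  have h4 : β (S (R x)) - x = β (S (R (x - y))) +
      β (S (R y - NormedSpace.inclusionInDoubleDual ℝ _ (z y))) + β (T (z y) - z y) - (x - y) := by
    simp only [map_sub, hSj, hβz]
    abel
  change ‖β (S (R x)) - x‖ < ε
  rw [h4]
  calc _ ≤ l * η + l * η + η + η :=
        (norm_sub_le _ _).trans (add_le_add (norm_add₃_le.trans (add_le_add (add_le_add h1 h2) h3)) hxy'.le)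
    _ < ε := by linarith

end BAP

end

/-! ### The transfer principle and the five classical ideals -/

theorem mainTheorem3 :
    (∀ A : OperatorClass.{u}, IsOperatorIdeal A →
      ∀ (X : Type u) [NormedAddCommGroup X] [NormedSpace ℝ X] [CompleteSpace X],
        BidualCondition A (LipFree X) →
          ∀ l : ℝ, 1 ≤ l → HasBAP A l (LipFree X) → HasBAP A l X) ∧
    (∀ A : OperatorClass.{u},
      (A = finiteRankOps ∨ A = compactOps ∨ A = weaklyCompactOps ∨
        ∃ p : ℝ, 1 ≤ p ∧ (A = pCompactOps p ∨ A = pSummingOps p)) →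
      IsOperatorIdeal A ∧
      ∀ (X : Type u) [NormedAddCommGroup X] [NormedSpace ℝ X] [CompleteSpace X],
        BidualCondition A (LipFree X) ∧
          ∀ l : ℝ, 1 ≤ l → HasBAP A l (LipFree X) → HasBAP A l X) := by
  refine ⟨fun A hA X _ _ _ hb l hl h => h.of_lipFree hA hb hl, fun A hA => ?_⟩
  -- For the classical ideals the bidual condition holds on every Banach space; nothing specific to
  -- free spaces is needed.
  suffices h : IsOperatorIdeal A ∧ ∀ (Z : Type u) [NormedAddCommGroup Z] [NormedSpace ℝ Z]
      [CompleteSpace Z], BidualCondition A Z from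
    ⟨h.1, fun X _ _ _ => ⟨h.2 _, fun l hl hX => hX.of_lipFree h.1 (h.2 _) hl⟩⟩
  obtain rfl | rfl | rfl | ⟨p, hp, rfl | rfl⟩ := hA
  · exact ⟨isOperatorIdeal_finiteRankOps, fun Z _ _ _ => bidualCondition_finiteRankOps Z⟩
  · exact ⟨isOperatorIdeal_compactOps, fun Z _ _ _ => bidualCondition_compactOps Z⟩
  · exact ⟨isOperatorIdeal_weaklyCompactOps, fun Z _ _ _ => bidualCondition_weaklyCompactOps Z⟩
  · exact ⟨isOperatorIdeal_pCompactOps hp, fun Z _ _ _ => bidualCondition_pCompactOps hp Z⟩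
  · exact ⟨isOperatorIdeal_pSummingOps hp, fun Z _ _ _ => bidualCondition_pSummingOps hp Z⟩
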